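/- Let $d\ge 1$ and let $\Omega\subset\mathbb{R}^d$ be a bounded polygonal (polyhedral) domain, i.e. a bounded nonempty connected open set with $\operatorname{int}\overline\Omega=\Omega$ whose boundary is contained in a finite union of hyperplanes; $n$ is its outward unit normal. Let $(\cdot,\cdot)$ and $\langle\cdot,\cdot\rangle$ denote the $L^2(\Omega)$ and $L^2(\partial\Omega)$ inner products. On the boundary, $H^1(\Omega)$ functions are understood through their $L^2(\partial\Omega)$ traces, where $\gamma$ is the trace of $v$ if some functions $w_k\in C^\infty(\mathbb{R}^d)$ satisfy $w_k\to v$ in $H^1(\Omega)$ and $w_k|_{\partial\Omega}\to\gamma$ in $L^2(\partial\Omega)$. Let $\mathbf{RM}=\{x\mapsto a+Bx:\ a\in\mathbb{R}^d,\ B\in\mathbb{R}^{d\times d},\ B^T=-B\}$ and let $\mathbf{H}^1_\perp(\Omega)$ be the set of $\mathbf v\in\mathbf{H}^1(\Omega)=H^1(\Omega)^d$ with $(\mathbf v,\mathbf r)=0$ for all $\mathbf r\in\mathbf{RM}$. Put $\varepsilon(\mathbf v)=\frac12(\nabla\mathbf v+\nabla\mathbf v^T)$. Let $\mu>0$, $\mu_f>0$,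 $c_0\ge0$ and $\lambda,\alpha\in\mathbb{R}$ with $\alpha^2+\lambda c_0>0$, and set $$\kappa_1=\frac{\alpha}{\alpha^2+\lambda c_0},\qquad \kappa_2=\frac{\lambda}{\alpha^2+\lambda c_0},\qquad \kappa_3=\frac{c_0}{\alpha^2+\lambda c_0}.$$ Let $K\in L^\infty(\Omega;\mathbb{R}^{d\times d})$ be symmetric, $\rho_f\in L^\infty(\Omega)$, $\mathbf g,\mathbf f\in \mathbf L^2(\Omega)$, $\mathbf f_1\in\mathbf L^2(\partial\Omega)$, $\phi\in L^2(\Omega)$, $\phi_1\in L^2(\partial\Omega)$ (all independent of time), $\mathbf u_0\in\mathbf H^1(\Omega)$, $p_0\in L^2(\Omega)$, $q_0=\operatorname{div}\mathbf u_0$, $\eta_0=c_0p_0+\alpha q_0$, and assume $(\mathbf f,\mathbf r)+\langle\mathbf f_1,\mathbf r\rangle=0$ for all $\mathbf r\in\mathbf{RM}$. Let $T>0$. A weak solution is a tuple $(\mathbf u,\xi,\eta,p,q)$ with $\mathbf u\in L^\infty(0,T;\mathbf H^1_\perp(\Omega))$, $\xi\in L^2(0,T;L^2(\Omega))$, $\eta\in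 L^\infty(0,T;L^2(\Omega))\cap H^1(0,T;H^1(\Omega)')$, $q\in L^\infty(0,T;L^2(\Omega))$, $p\in L^2(0,T;H^1(\Omega))$, such that $p=\kappa_1\xi+\kappa_2\eta$ and $q=\kappa_1\eta-\kappa_3\xi$, and for almost every $t\in(0,T)$ $$\mu(\varepsilon(\mathbf u),\varepsilon(\mathbf v))-(\xi,\operatorname{div}\mathbf v)=(\mathbf f,\mathbf v)+\langle\mathbf f_1,\mathbf v\rangle\quad\forall\,\mathbf v\in\mathbf H^1(\Omega),$$ $$\kappa_3(\xi,\varphi)+(\operatorname{div}\mathbf u,\varphi)=\kappa_1(\eta,\varphi)\quad\forall\,\varphi\in L^2(\Omega),$$ $$(\eta_t,\psi)_{\rm dual}+\frac1{\mu_f}\bigl(K(\nabla(\kappa_1\xi+\kappa_2\eta)-\rho_f\mathbf g),\nabla\psi\bigr)=(\phi,\psi)+\langle\phi_1,\psi\rangle\quad\forall\,\psi\in H^1(\Omega),$$ with initial values $\mathbf u(0)=\mathbf u_0$, $p(0)=p_0$, $q(0)=q_0$, $\eta(0)=\eta_0$, where $z(0)=z_0$ means that $(z(t),\psi)\to(z_0,\psi)$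 as an essential limit for $t\to0^+$, for every $\psi\in H^1(\Omega)$ (componentwise for $\mathbf u$). Then every weak solution satisfies, for almost every $t\in(0,T)$, with $C_\eta(t)=(\eta(t),1)$, $C_\xi(t)=(\xi(t),1)$, $C_q(t)=(q(t),1)$ and $C_p(t)=(p(t),1)$: $$C_\eta(t)=(\eta_0,1)+\bigl[(\phi,1)+\langle\phi_1,1\rangle\bigr]t,$$ $$C_\xi(t)=\frac1{d+\mu\kappa_3}\bigl[\mu\kappa_1C_\eta(t)-(\mathbf f,x)-\langle\mathbf f_1,x\rangle\bigr],$$ $$C_q(t)=\kappa_1C_\eta(t)-\kappa_3C_\xi(t),\qquad C_p(t)=\kappa_1C_\xi(t)+\kappa_2C_\eta(t),$$ $$\langle\mathbf u(t)\cdot n,1\rangle=C_q(t),$$ where in the last formula $\mathbf u(t)|_{\partial\Omega}$ is the trace of $\mathbf u(t)$. Moreover the formula for $C_\eta(t)$ holds for all $t\in[0,T]$ for every representative of $\eta$ for which $t\mapsto(\eta(t),1)$ is continuous on $[0,T]$. -/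

import Mathlib

open MeasureTheory Set Filter Topology
open scoped ContDiff

namespace Poro

noncomputable section

/-- Euclidean space of dimension `d`. -/
abbrev E (d : ℕ) : Type := EuclideanSpace ℝ (Fin d)

variable {d : ℕ}

/-! ### The domain, its boundary and its outward normal -/

/-- A bounded polygonal (polyhedral) domain: a bounded, nonempty, connected open set which lies on
one side of its boundary, and whose boundary is contained in finitely many (affine) hyperplanes. -/
structure IsPolygonalDomain (Ω : Set (E d)) : Prop where
  isOpen : IsOpen Ω
  isConnected : IsConnected Ω
  isBounded : Bornology.IsBounded Ω
  interior_closure : interior (closure Ω) = Ω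
  frontier_subset : ∃ (m : ℕ) (a : Fin m → E d) (b : Fin m → ℝ),
    (∀ k, a k ≠ 0) ∧ frontier Ω ⊆ ⋃ k, {x | inner ℝ (a k) x = b k}

/-- Surface measure on the boundary: the `(d-1)`-dimensional Hausdorff measure (normalised so
as to agree with Lebesgue measure on hyperplanes; counting measure for `d = 1`). -/
def surf (Ω : Set (E d)) : Measure (E d) :=
  (Measure.euclideanHausdorffMeasure (d - 1)).restrict (frontier Ω)

/-- `ν` is the outward unit normal of `Ω` at `x`: near `x`, the set `Ω` is the open half ball on the
side opposite to `ν`. -/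
def IsOutwardNormal (Ω : Set (E d)) (x ν : E d) : Prop :=
  ‖ν‖ = 1 ∧ ∃ r > 0, ∀ y ∈ Metric.ball x r, (y ∈ Ω ↔ inner ℝ ν (y - x) < 0)

open Classical in
/-- The outward unit normal field `n` on the boundary. It is determined at every point at which the
boundary is flat, that is, at surface-almost every point of the boundary of a polygonal domain;
the value at the remaining points (vertices, edges) is irrelevant and set to `0`. -/
def normal (Ω : Set (E d)) (x : E d) : E d :=
  if h : ∃ ν, IsOutwardNormal Ω x ν then h.choose else 0

/-! ### Lebesgue and Sobolev spaces -/

/-- `L²(Ω)`. -/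
abbrev L2 (Ω : Set (E d)) : Type := Lp ℝ 2 (volume.restrict Ω)

/-- `L²(∂Ω)`. -/
abbrev L2bd (Ω : Set (E d)) : Type := Lp ℝ 2 (surf Ω)

/-- The pairing `(a, b) = ∫_Ω a b dx`. -/
def ip (Ω : Set (E d)) (a b : E d → ℝ) : ℝ := ∫ x in Ω, a x * b x

/-- The pairing `⟨a, b⟩ = ∫_∂Ω a b dS`. -/
def bp (Ω : Set (E d)) (a b : E d → ℝ) : ℝ := ∫ x, a x * b x ∂(surf Ω)

/-- The classical partial derivative `∂ᵢ φ`. -/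
def pderiv (i : Fin d) (φ : E d → ℝ) (x : E d) : ℝ :=
  fderiv ℝ φ x (EuclideanSpace.single i 1)

/-- `φ ∈ C_c^∞(Ω)`. -/
structure IsTestFun (Ω : Set (E d)) (φ : E d → ℝ) : Prop where
  contDiff : ContDiff ℝ ∞ φ
  hasCompactSupport : HasCompactSupport φ
  tsupport_subset : tsupport φ ⊆ Ω

/-- `w = (w₁, …, w_d)` is the weak gradient of `v` in `Ω`. -/
def IsWeakGrad (Ω : Set (E d)) (v : L2 Ω) (w : Fin d → L2 Ω) : Prop :=
  ∀ φ : E d → ℝ, IsTestFun Ω φ → ∀ i, ip Ω v (pderiv i φ) = - ip Ω (w i) φ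

lemma integrable_mul_of_continuous (Ω : Set (E d)) (v : L2 Ω) {φ : E d → ℝ}
    (hc : Continuous φ) (hs : HasCompactSupport φ) :
    Integrable (fun x => v x * φ x) (volume.restrict Ω) :=
  (Lp.memLp v).integrable_mul (hc.memLp_of_hasCompactSupport (p := 2) hs)

lemma IsTestFun.continuous_pderiv {Ω : Set (E d)} {φ : E d → ℝ} (h : IsTestFun Ω φ) (i : Fin d) :
    Continuous (pderiv i φ) :=
  (h.contDiff.continuous_fderiv (by simp)).clm_apply continuous_const

lemma IsTestFun.hasCompactSupport_pderiv {Ω : Set (E d)} {φ : E d → ℝ} (h : IsTestFun Ω φ)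
    (i : Fin d) : HasCompactSupport (pderiv i φ) := by
  have h1 := h.hasCompactSupport.fderiv (𝕜 := ℝ)
  exact h1.comp_left (g := fun L : E d →L[ℝ] ℝ => L (EuclideanSpace.single i 1)) (by simp)

lemma ip_add_left (Ω : Set (E d)) (v w : L2 Ω) {φ : E d → ℝ}
    (hc : Continuous φ) (hs : HasCompactSupport φ) :
    ip Ω (v + w : L2 Ω) φ = ip Ω v φ + ip Ω w φ := by
  unfold ip
  rw [← integral_add (integrable_mul_of_continuous Ω v hc hs)
    (integrable_mul_of_continuous Ω w hc hs)]
  refine integral_congr_ae ?_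
  filter_upwards [Lp.coeFn_add v w] with x hx
  rw [hx, Pi.add_apply, add_mul]

lemma ip_smul_left (Ω : Set (E d)) (c : ℝ) (v : L2 Ω) (φ : E d → ℝ) :
    ip Ω (c • v : L2 Ω) φ = c * ip Ω v φ := by
  unfold ip
  rw [← integral_const_mul]
  refine integral_congr_ae ?_
  filter_upwards [Lp.coeFn_smul c v] with x hx
  rw [hx, Pi.smul_apply, smul_eq_mul, mul_assoc]

/-- The Sobolev space `H¹(Ω)`, realised as the space of pairs `(v, ∇v)`, with the Hilbert norm
`(‖v‖² + ∑ᵢ ‖∂ᵢ v‖²)^{1/2}`. -/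
def H1 (Ω : Set (E d)) : Submodule ℝ (WithLp 2 (L2 Ω × PiLp 2 (fun _ : Fin d => L2 Ω))) where
  carrier := {z | IsWeakGrad Ω z.fst (fun i => z.snd i)}
  zero_mem' := by
    intro φ hφ i
    have h (ψ : E d → ℝ) : ip Ω (0 : L2 Ω) ψ = 0 := by
      have := ip_smul_left Ω 0 (0 : L2 Ω) ψ
      simpa using this
    simp only [WithLp.zero_fst, WithLp.zero_snd, PiLp.zero_apply]
    rw [h, h, neg_zero]
  add_mem' := by
    intro a b ha hb φ hφ i
    have h1 := ha φ hφ i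
    have h2 := hb φ hφ i
    simp only [WithLp.add_fst, WithLp.add_snd, PiLp.add_apply]
    rw [ip_add_left Ω _ _ (hφ.continuous_pderiv i) (hφ.hasCompactSupport_pderiv i),
      ip_add_left Ω _ _ hφ.contDiff.continuous hφ.hasCompactSupport, h1, h2]
    ring
  smul_mem' := by
    intro c a ha φ hφ i
    have h1 := ha φ hφ i
    simp only [WithLp.smul_fst, WithLp.smul_snd, PiLp.smul_apply]
    rw [ip_smul_left, ip_smul_left, h1]
    ring

/-- The function in `L²(Ω)` underlying an element of `H¹(Ω)`. -/
def toL2 {Ω : Set (E d)} (v : H1 Ω) : L2 Ω := v.1.fst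

/-- The weak partial derivative `∂ᵢ v`. -/
def pd {Ω : Set (E d)} (v : H1 Ω) (i : Fin d) : L2 Ω := v.1.snd i

/-- The space `H¹(Ω)^d` of vector fields. -/
abbrev H1V (Ω : Set (E d)) : Type := PiLp 2 (fun _ : Fin d => H1 Ω)

/-- `g ∈ L²(∂Ω)` is the boundary trace of `v ∈ H¹(Ω)`: there are functions `wₖ`, smooth up to the
boundary, with `wₖ → v` in `H¹(Ω)` and `wₖ|_∂Ω → g` in `L²(∂Ω)`. This is the graph of the usual
trace operator, which is the continuous extension of the restriction to the boundary. -/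
def IsTrace {Ω : Set (E d)} (v : H1 Ω) (g : L2bd Ω) : Prop :=
  ∃ w : ℕ → E d → ℝ, (∀ k, ContDiff ℝ ∞ (w k)) ∧
    Tendsto (fun k => eLpNorm (fun x => w k x - toL2 v x) 2 (volume.restrict Ω)) atTop (𝓝 0) ∧
    (∀ i, Tendsto (fun k => eLpNorm (fun x => pderiv i (w k) x - pd v i x) 2 (volume.restrict Ω))
      atTop (𝓝 0)) ∧
    Tendsto (fun k => eLpNorm (fun x => w k x - g x) 2 (surf Ω)) atTop (𝓝 0)

/-- The trace of a vector field, componentwise. -/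
def IsTraceV {Ω : Set (E d)} (v : H1V Ω) (g : Fin d → L2bd Ω) : Prop :=
  ∀ i, IsTrace (v i) (g i)

/-- The divergence of a vector field in `H¹(Ω)^d`. -/
def div {Ω : Set (E d)} (v : H1V Ω) : L2 Ω := ∑ i, pd (v i) i

/-- The strain tensor `ε(v) = (∇v + ∇vᵀ)/2`. -/
def strain {Ω : Set (E d)} (v : H1V Ω) (i j : Fin d) : L2 Ω :=
  (1 / 2 : ℝ) • (pd (v i) j + pd (v j) i)

/-- Infinitesimal rigid motions `r(x) = a + B x` with `B` skew-symmetric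
(`B x = b × x` in three dimensions). -/
def IsRigidMotion (r : E d → Fin d → ℝ) : Prop :=
  ∃ (a : Fin d → ℝ) (B : Matrix (Fin d) (Fin d) ℝ), B.transpose = -B ∧
    ∀ x i, r x i = a i + ∑ j, B i j * x j

/-- `v ∈ H¹_⊥(Ω)`: `v` is orthogonal in `L²(Ω)^d` to all infinitesimal rigid motions. -/
def IsPerpRM {Ω : Set (E d)} (v : H1V Ω) : Prop :=
  ∀ r : E d → Fin d → ℝ, IsRigidMotion r → ∑ i, ip Ω (toL2 (v i)) (fun x => r x i) = 0

/-! ### Functions of time -/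

/-- Lebesgue measure on the time interval `(0, T)`. -/
def timeMeasure (T : ℝ) : Measure ℝ := volume.restrict (Ioo 0 T)

/-- `ζ` is the weak time derivative on `(0, T)` of `z`, a function with values in `L²(Ω)`, which
is embedded in the dual of `H¹(Ω)` by `⟨z, ψ⟩ = (z, ψ)`. -/
def IsWeakTimeDeriv {Ω : Set (E d)} (T : ℝ) (z : ℝ → L2 Ω) (ζ : ℝ → (H1 Ω →L[ℝ] ℝ)) : Prop :=
  ∀ θ : ℝ → ℝ, ContDiff ℝ ∞ θ → HasCompactSupport θ → tsupport θ ⊆ Ioo 0 T → ∀ ψ : H1 Ω,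
    ∫ t, deriv θ t * ip Ω (z t) (toL2 ψ) ∂(timeMeasure T) = - ∫ t, θ t * ζ t ψ ∂(timeMeasure T)

/-- The initial condition `z(0) = z₀` for (classes of) functions of time: `z(t) → z₀` weakly, when
tested with functions in `H¹(Ω)`, as an essential limit for `t → 0+`. -/
def HasInitialValue {Ω : Set (E d)} (z : ℝ → L2 Ω) (z₀ : L2 Ω) : Prop :=
  ∀ ψ : H1 Ω, Tendsto (fun t => ip Ω (z t) (toL2 ψ)) (𝓝[>] 0 ⊓ ae volume) (𝓝 (ip Ω z₀ (toL2 ψ)))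

/-! ### The poroelasticity problem -/

/-- Parameters and data of the poroelasticity problem. -/
structure Data (Ω : Set (E d)) where
  /-- second Lamé constant -/
  μ : ℝ
  /-- first Lamé constant -/
  lam : ℝ
  /-- Biot-Willis constant -/
  α : ℝ
  /-- constrained specific storage coefficient -/
  c₀ : ℝ
  /-- solvent viscosity -/
  μf : ℝ
  /-- permeability tensor -/
  K : E d → Matrix (Fin d) (Fin d) ℝ
  /-- solvent density -/
  ρf : E d → ℝ
  /-- gravity -/
  g : Fin d → L2 Ω
  /-- body force -/
  f : Fin d → L2 Ω
  /-- boundary traction -/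
  f₁ : Fin d → L2bd Ω
  /-- volume source -/
  φ : L2 Ω
  /-- boundary source -/
  φ₁ : L2bd Ω
  /-- initial displacement -/
  u₀ : H1V Ω
  /-- initial pressure -/
  p₀ : L2 Ω

namespace Data

variable {Ω : Set (E d)} (D : Data Ω)

/-- `κ₁ = α / (α² + λ c₀)`. -/
def κ₁ : ℝ := D.α / (D.α ^ 2 + D.lam * D.c₀)

/-- `κ₂ = λ / (α² + λ c₀)`. -/
def κ₂ : ℝ := D.lam / (D.α ^ 2 + D.lam * D.c₀)

/-- `κ₃ = c₀ / (α² + λ c₀)`. -/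
def κ₃ : ℝ := D.c₀ / (D.α ^ 2 + D.lam * D.c₀)

/-- `q₀ = div u₀`. -/
def q₀ : L2 Ω := div D.u₀

/-- `η₀ = c₀ p₀ + α q₀`. -/
def η₀ : L2 Ω := D.c₀ • D.p₀ + D.α • D.q₀

/-- Standing assumptions on the parameters and data. -/
structure Admissible : Prop where
  μ_pos : 0 < D.μ
  c₀_nonneg : 0 ≤ D.c₀
  denom_pos : 0 < D.α ^ 2 + D.lam * D.c₀
  μf_pos : 0 < D.μf
  K_symm : ∀ᵐ x ∂(volume.restrict Ω), (D.K x).IsSymm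
  K_bounded : ∀ i j, MemLp (fun x => D.K x i j) ⊤ (volume.restrict Ω)
  ρf_bounded : MemLp D.ρf ⊤ (volume.restrict Ω)
  /-- the loads are balanced: `(f, r) + ⟨f₁, r⟩ = 0` for all infinitesimal rigid motions -/
  balanced : ∀ r : E d → Fin d → ℝ, IsRigidMotion r →
    ∑ i, ip Ω (D.f i) (fun x => r x i) + ∑ i, bp Ω (D.f₁ i) (fun x => r x i) = 0

/-- Weak solutions `(u, ξ, η, p, q)` on `(0, T)` of the reformulated poroelasticity problem. -/
structure IsWeakSolution (T : ℝ) (u : ℝ → H1V Ω) (ξ η : ℝ → L2 Ω) (p : ℝ → H1 Ω)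
    (q : ℝ → L2 Ω) : Prop where
  /-- `u ∈ L^∞(0,T; H¹_⊥(Ω))` -/
  u_mem : MemLp u ⊤ (timeMeasure T)
  u_perp : ∀ᵐ t ∂(timeMeasure T), IsPerpRM (u t)
  /-- `ξ ∈ L²(0,T; L²(Ω))` -/
  ξ_mem : MemLp ξ 2 (timeMeasure T)
  /-- `η ∈ L^∞(0,T; L²(Ω))` -/
  η_mem : MemLp η ⊤ (timeMeasure T)
  /-- `q ∈ L^∞(0,T; L²(Ω))` -/
  q_mem : MemLp q ⊤ (timeMeasure T)
  /-- `p ∈ L²(0,T; H¹(Ω))` -/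
  p_mem : MemLp p 2 (timeMeasure T)
  /-- momentum balance -/
  momentum : ∀ᵐ t ∂(timeMeasure T), ∀ (v : H1V Ω) (γ : Fin d → L2bd Ω), IsTraceV v γ →
    D.μ * ∑ i, ∑ j, ip Ω (strain (u t) i j) (strain v i j) - ip Ω (ξ t) (div v)
      = ∑ i, ip Ω (D.f i) (toL2 (v i)) + ∑ i, bp Ω (D.f₁ i) (γ i)
  /-- volumetric constraint -/
  volumetric : ∀ᵐ t ∂(timeMeasure T), ∀ φ : L2 Ω,
    D.κ₃ * ip Ω (ξ t) φ + ip Ω (div (u t)) φ = D.κ₁ * ip Ω (η t) φ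
  /-- `η ∈ H¹(0,T; H¹(Ω)')` and the diffusion equation, in which
  `∇(κ₁ ξ + κ₂ η) = ∇p` by `p_eq` -/
  diffusion : ∃ ηt : ℝ → (H1 Ω →L[ℝ] ℝ), MemLp ηt 2 (timeMeasure T) ∧
    IsWeakTimeDeriv T η ηt ∧
    ∀ᵐ t ∂(timeMeasure T), ∀ (ψ : H1 Ω) (γ : L2bd Ω), IsTrace ψ γ →
      ηt t ψ + 1 / D.μf * ∑ i, ip Ω
          (fun x => ∑ j, D.K x i j * (pd (p t) j x - D.ρf x * D.g j x)) (pd ψ i)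
        = ip Ω D.φ (toL2 ψ) + bp Ω D.φ₁ γ
  p_eq : ∀ᵐ t ∂(timeMeasure T), toL2 (p t) = D.κ₁ • ξ t + D.κ₂ • η t
  q_eq : ∀ᵐ t ∂(timeMeasure T), q t = D.κ₁ • η t - D.κ₃ • ξ t
  u_init : ∀ i, HasInitialValue (fun t => toL2 (u t i)) (toL2 (D.u₀ i))
  p_init : HasInitialValue (fun t => toL2 (p t)) D.p₀
  q_init : HasInitialValue q D.q₀
  η_init : HasInitialValue η D.η₀

end Data

end

end Poro

/-! Each identity comes from testing a weak equation with one special function. Testing the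
diffusion equation with ψ = 1 removes the flux term, so (η(t), 1) has the constant weak derivative
(φ, 1) + ⟨φ₁, 1⟩. By du Bois-Reymond it is affine, and the initial condition fixes the constant.
Testing the momentum balance with v(x) = x, for which ε(v) = I and div v = d, gives μ (div u, 1) - d
(ξ, 1) = (f, x) + ⟨f₁, x⟩. The volumetric constraint tested with 1 gives (div u, 1) = κ₁ C_η - κ₃
C_ξ, and eliminating (div u, 1) yields C_ξ. The values of C_q and C_p follow by linearity.

The flux identity needs the divergence theorem on a polyhedral domain whose boundary is only known
to lie in finitely many hyperplanes. Off the null set where two different hyperplanes meet, the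
boundary is flat and has a normal (`CoversFrontier.exists_mem_face`). For a direction e and almost
every x, the indicator of Ω at x is the number of exits minus the number of entries of the ray from
x along e (`CoversFrontier.indicator_eq_sum_crossing`). Multiplying by the derivative of w along e
and integrating line by line, each face p = (ν, b) contributes ⟪ν, e⟫ times the integral of w over
it (`integral_crossing_mul_fderiv`). The theorem passes from smooth functions to H¹ functions with a
trace by L² limits. No trace theorem is needed, because the flux identity concerns any γ that is a
trace. -/

namespace Poro

/-! ### Coordinates adapted to a hyperplane -/

/-- `B` parametrises isometrically the hyperplane orthogonal to the vector `a`, and together with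
`a` it gives measure preserving coordinates on the whole space. -/
structure IsHyperplaneChart {m : ℕ} (a : E (m + 1)) (B : E m →ₗᵢ[ℝ] E (m + 1)) : Prop where
  norm_eq_one : ‖a‖ = 1
  inner_eq_zero_iff : ∀ x, inner ℝ a x = 0 ↔ x ∈ range B
  measurePreserving : MeasurePreserving (fun z : ℝ × E m => z.1 • a + B z.2)
    (volume.prod volume) volume

/-- An orthonormal basis of the orthogonal complement of a supplies B. By Pythagoras (s, y) ↦ s a +
B y is isometric for the Euclidean product norm, hence a linear isometric equivalence by dimension
count, hence measure preserving. `WithLp 2` is there because the plain product carries the sup norm.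
-/
lemma exists_isHyperplaneChart {m : ℕ} {a : E (m + 1)} (ha : ‖a‖ = 1) :
    ∃ B, IsHyperplaneChart a B := by
  have : Fact (Module.finrank ℝ (E (m + 1)) = m + 1) := ⟨by simp⟩
  have ha0 : a ≠ 0 := by rintro rfl; simp at ha
  let b := OrthonormalBasis.fromOrthogonalSpanSingleton (𝕜 := ℝ) m ha0
  let B : E m →ₗᵢ[ℝ] E (m + 1) :=
    (ℝ ∙ a)ᗮ.subtypeₗᵢ.comp b.repr.symm.toLinearIsometry
  have hB (y : E m) : inner ℝ a (B y) = 0 :=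
    Submodule.mem_orthogonal_singleton_iff_inner_right.1 (b.repr.symm y).2
  let L : WithLp 2 (ℝ × E m) →ₗ[ℝ] E (m + 1) :=
    { toFun := fun z => z.fst • a + B z.snd
      map_add' := by intro x y; simp [add_smul]; abel
      map_smul' := by intro c x; simp [mul_smul] }
  have hL (z) : ‖L z‖ = ‖z‖ := by
    have h1 : ‖L z‖ ^ 2 = ‖z‖ ^ 2 := by
      have : ‖z.fst • a + B z.snd‖ ^ 2 = ‖z.fst‖ ^ 2 + ‖z.snd‖ ^ 2 := by
        rw [norm_add_sq_real, inner_smul_left, hB, norm_smul, ha, B.norm_map]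
        simp
      rw [WithLp.prod_norm_sq_eq_of_L2]
      exact this
    exact (pow_left_inj₀ (norm_nonneg _) (norm_nonneg _) two_ne_zero).1 h1
  let Li : WithLp 2 (ℝ × E m) →ₗᵢ[ℝ] E (m + 1) := ⟨L, hL⟩
  have hf : Module.finrank ℝ (WithLp 2 (ℝ × E m)) = Module.finrank ℝ (E (m + 1)) := by
    rw [(WithLp.linearEquiv 2 ℝ (ℝ × E m)).finrank_eq]
    simp [add_comm]
  have hmp := (Li.toLinearIsometryEquiv hf).measurePreserving.comp
    (WithLp.volume_preserving_toLp ℝ (E m))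
  refine ⟨B, ha, fun x => ⟨fun hx => ?_, ?_⟩, hmp⟩
  · refine ⟨b.repr ⟨x, Submodule.mem_orthogonal_singleton_iff_inner_right.2 hx⟩, ?_⟩
    simp [B]
  · rintro ⟨y, rfl⟩
    exact hB y

namespace IsHyperplaneChart

variable {m : ℕ} {a : E (m + 1)} {B : E m →ₗᵢ[ℝ] E (m + 1)}

lemma inner_apply (h : IsHyperplaneChart a B) (y : E m) : inner ℝ a (B y) = 0 :=
  (h.inner_eq_zero_iff _).2 ⟨y, rfl⟩

lemma inner_self (h : IsHyperplaneChart a B) : inner ℝ a a = 1 := by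
  rw [real_inner_self_eq_norm_sq, h.norm_eq_one, one_pow]

lemma range_eq (h : IsHyperplaneChart a B) (b : ℝ) :
    range (fun y => b • a + B y) = {x | inner ℝ a x = b} := by
  ext x
  constructor
  · rintro ⟨y, rfl⟩
    simp [inner_add_right, inner_smul_right, h.inner_apply, h.norm_eq_one]
  · intro hx
    obtain ⟨y, hy⟩ := (h.inner_eq_zero_iff (x - b • a)).1 (by
      rw [inner_sub_right, inner_smul_right, h.inner_self, hx]; simp)
    exact ⟨y, by simp [hy]⟩

lemma isometry (B : E m →ₗᵢ[ℝ] E (m + 1)) (a : E (m + 1)) (b : ℝ) :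
    Isometry (fun y => b • a + B y) :=
  (isometry_add_left (b • a)).comp B.isometry

/-- The surface measure of a hyperplane is the image of Lebesgue measure. -/
lemma map_volume (h : IsHyperplaneChart a B) (b : ℝ) :
    (volume : Measure (E m)).map (fun y => b • a + B y) =
      (Measure.euclideanHausdorffMeasure m).restrict {x | inner ℝ a x = b} := by
  rw [← h.range_eq b, ← (isometry B a b).map_euclideanHausdorffMeasure,
    EuclideanSpace.euclideanHausdorffMeasure_eq_volume]

/-- Oblique coordinates: translating the hyperplane `{inner a x = b}` in direction `e`. -/
lemma measurePreserving_oblique (h : IsHyperplaneChart a B) (b : ℝ) {e : E (m + 1)}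
    (he : inner ℝ a e ≠ 0) :
    MeasurePreserving (fun z : ℝ × E m => b • a + B z.2 + z.1 • e)
      (ENNReal.ofReal |inner ℝ a e| • (volume.prod volume)) volume := by
  set c := inner ℝ a e with hc
  -- Writing e = c a + B v factors the oblique map into a scaling of the first coordinate by c, a
  -- shear along v, the orthogonal chart and a translation. Only the scaling changes the measure.
  obtain ⟨v, hv⟩ := (h.inner_eq_zero_iff (e - c • a)).1 (by
      rw [inner_sub_right, inner_smul_right, h.inner_self, ← hc]; simp)
  have hscale : MeasurePreserving (fun z : ℝ × E m => (c * z.1, z.2))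
      (ENNReal.ofReal |c| • (volume.prod volume)) (volume.prod volume) := by
    have h1 : MeasurePreserving (fun s : ℝ => c * s) (ENNReal.ofReal |c| • volume) volume :=
      ⟨by fun_prop, by rw [Measure.map_smul, Real.smul_map_volume_mul_left he]⟩
    have := h1.prod (MeasurePreserving.id (volume : Measure (E m)))
    rwa [Measure.prod_smul_left] at this
  have hshear : MeasurePreserving (fun z : ℝ × E m => (z.1, z.2 + (c⁻¹ * z.1) • v))
      (volume.prod volume) (volume.prod volume) := by
    refine (MeasurePreserving.id (volume : Measure ℝ)).skew_product
      (g := fun s y => y + (c⁻¹ * s) • v) (by fun_prop) (Eventually.of_forall fun s => ?_)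
    exact (measurePreserving_add_right volume _).map_eq
  have := (measurePreserving_add_left (volume : Measure (E (m + 1))) (b • a)).comp
    (h.measurePreserving.comp (hshear.comp hscale))
  convert! this using 2 with z
  simp only [Function.comp, map_add, map_smul, hv]
  rw [inv_mul_cancel_left₀ he, smul_sub, mul_comm c, mul_smul]
  abel

end IsHyperplaneChart

/-! ### Null sets -/

/-- A nonempty level set is a translate of the kernel, a proper subspace. The case l = 0, c ≠ 0 is
admitted because a hyperplane parallel to a chart pulls back to such an empty set. -/
lemma volume_level_set {d : ℕ} (l : E d →L[ℝ] ℝ) (c : ℝ) (h : l ≠ 0 ∨ c ≠ 0) :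
    volume {x | l x = c} = 0 := by
  by_cases hne : ∃ x₀, l x₀ = c
  · obtain ⟨x₀, hx₀⟩ := hne
    have hl : l ≠ 0 := by
      rintro rfl
      simp at hx₀
      exact h.elim (fun h => h rfl) (fun h => h hx₀.symm)
    have h0 : volume ((LinearMap.ker (l : E d →ₗ[ℝ] ℝ) : Submodule ℝ (E d)) : Set (E d)) = 0 := by
      refine Measure.addHaar_submodule _ _ ?_
      intro htop
      apply hl
      ext1 x
      have : x ∈ LinearMap.ker (l : E d →ₗ[ℝ] ℝ) := htop ▸ Submodule.mem_top
      simpa using this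
    have h1 : {x | l x = c} =
        (fun x => -x₀ + x) ⁻¹' ((LinearMap.ker (l : E d →ₗ[ℝ] ℝ) : Submodule ℝ (E d)) : Set (E d)) := by
      ext x
      simp only [mem_ofPred_eq, mem_preimage, SetLike.mem_coe, LinearMap.mem_ker,
        ContinuousLinearMap.coe_coe, map_add, map_neg, hx₀]
      constructor <;> intro h <;> linarith
    rw [h1, measure_preimage_add, h0]
  · have : {x | l x = c} = ∅ := by
      ext x; simp; intro hx; exact hne ⟨x, hx⟩
    simp [this]

lemma volume_hyperplane {d : ℕ} {a : E d} (ha : ‖a‖ = 1) (b : ℝ) :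
    volume {x : E d | inner ℝ a x = b} = 0 := by
  refine volume_level_set (innerSL ℝ a) b (Or.inl ?_)
  intro h
  have := congrArg (fun l => l a) h
  simp [ha] at this

/-- In the chart the second hyperplane is a level set of y ↦ ⟪a', B y⟫. If this functional vanishes,
then a' = ±a, and a matching level would force (a', b') = ±(a, b). -/
lemma volume_chart_preimage_hyperplane {m : ℕ} {a a' : E (m + 1)} {B : E m →ₗᵢ[ℝ] E (m + 1)}
    (h : IsHyperplaneChart a B) (ha' : ‖a'‖ = 1) {b b' : ℝ} (h1 : (a', b') ≠ (a, b))
    (h2 : (a', b') ≠ -(a, b)) :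
    volume ((fun y => b • a + B y) ⁻¹' {x | inner ℝ a' x = b'}) = 0 := by
  have key := volume_level_set ((innerSL ℝ a').comp B.toContinuousLinearMap)
    (b' - b * inner ℝ a' a) ?_
  · convert! key using 2
    ext y
    simp [inner_add_right, inner_smul_right, eq_sub_iff_add_eq, add_comm]
  · by_contra! hcon
    obtain ⟨hl, hb⟩ := hcon
    set c := inner ℝ a a' with hc
    obtain ⟨v, hv⟩ := (h.inner_eq_zero_iff (a' - c • a)).1 (by
        rw [inner_sub_right, inner_smul_right, h.inner_self, ← hc]; simp)
    have hv0 : inner ℝ a' (B v) = 0 := by simpa using congrArg (fun l => l v) hl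
    have hz : a' - c • a = 0 := by
      rw [← inner_self_eq_zero (𝕜 := ℝ), inner_sub_left]
      nth_rewrite 1 [← hv]
      rw [hv0, inner_smul_left, ← hv, h.inner_apply]; simp
    have hac : a' = c • a := sub_eq_zero.1 hz
    have hc1 : |c| = 1 := by
      have := ha'
      rwa [hac, norm_smul, h.norm_eq_one, mul_one] at this
    rw [real_inner_comm, ← hc] at hb
    rcases (abs_eq zero_le_one).1 hc1 with h' | h' <;> rw [h'] at hac hb
    · exact h1 (by ext1 <;> simp [hac]; linarith)
    · exact h2 (by ext1 <;> simp [hac]; linarith)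

section Faces

variable {d : ℕ} {Ω : Set (E d)}

/-! ### Faces of a polygonal domain -/

/-- The hyperplane `{x | ⟪ν, x⟫ = b}` encoded by the pair `(ν, b)`. -/
def hyperplane (p : E d × ℝ) : Set (E d) := {x | inner ℝ p.1 x = p.2}

/-- The boundary points on the hyperplane `p = (ν, b)` at which `ν` is the outward normal. -/
def face (Ω : Set (E d)) (p : E d × ℝ) : Set (E d) := {x ∈ hyperplane p | IsOutwardNormal Ω x p.1}

/-- The points on two different hyperplanes from the family `P`. -/
def edges (P : Finset (E d × ℝ)) : Set (E d) :=
  ⋃ p ∈ P, ⋃ q ∈ P, ⋃ (_ : q ≠ p ∧ q ≠ -p), hyperplane p ∩ hyperplane q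

/-- `P` is a finite family of hyperplanes covering the boundary of `Ω`, each one occurring with both
orientations. -/
structure CoversFrontier (Ω : Set (E d)) (P : Finset (E d × ℝ)) : Prop where
  norm_eq_one : ∀ p ∈ P, ‖p.1‖ = 1
  neg_mem : ∀ p ∈ P, -p ∈ P
  frontier_subset : ∀ x ∈ frontier Ω, ∃ p ∈ P, x ∈ hyperplane p

lemma isClosed_hyperplane (p : E d × ℝ) : IsClosed (hyperplane p) :=
  isClosed_eq (by fun_prop) continuous_const

lemma hyperplane_neg (p : E d × ℝ) : hyperplane (-p) = hyperplane p := by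
  ext x
  simp [hyperplane]

lemma IsPolygonalDomain.exists_coversFrontier (hΩ : IsPolygonalDomain Ω) :
    ∃ P, CoversFrontier Ω P := by
  classical
  obtain ⟨m, a, b, ha, hf⟩ := hΩ.frontier_subset
  let f : Fin m → E d × ℝ := fun k => (‖a k‖⁻¹ • a k, ‖a k‖⁻¹ * b k)
  have hn (k) : ‖(f k).1‖ = 1 := by
    simp only [f]
    rw [norm_smul, norm_inv, norm_norm, inv_mul_cancel₀ (norm_ne_zero_iff.2 (ha k))]
  refine ⟨Finset.univ.image f ∪ Finset.univ.image (fun k => -f k), ?_, ?_, ?_⟩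
  · intro p hp
    simp only [Finset.mem_union, Finset.mem_image, Finset.mem_univ, true_and] at hp
    rcases hp with ⟨k, rfl⟩ | ⟨k, rfl⟩
    · exact hn k
    · rw [Prod.fst_neg, norm_neg, hn k]
  · intro p hp
    simp only [Finset.mem_union, Finset.mem_image, Finset.mem_univ, true_and] at hp ⊢
    rcases hp with ⟨k, rfl⟩ | ⟨k, rfl⟩
    · exact Or.inr ⟨k, rfl⟩
    · exact Or.inl ⟨k, by simp⟩
  · intro x hx
    obtain ⟨k, hk⟩ := mem_iUnion.1 (hf hx)
    refine ⟨f k, by simp, ?_⟩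
    have hk' : inner ℝ (a k) x = b k := hk
    simp [f, hyperplane, inner_smul_left, hk']

lemma IsOutwardNormal.eventually {x ν : E d} (h : IsOutwardNormal Ω x ν) :
    ∀ᶠ y in 𝓝 x, (y ∈ Ω ↔ inner ℝ ν (y - x) < 0) := by
  obtain ⟨_, r, hr, h⟩ := h
  filter_upwards [Metric.ball_mem_nhds x hr] with y hy using h y hy

/-- If ν ≠ ν', a small step from x in direction ν' - ν goes inward according to ν and outward
according to ν'. -/
lemma IsOutwardNormal.eq {x ν ν' : E d} (h : IsOutwardNormal Ω x ν)
    (h' : IsOutwardNormal Ω x ν') : ν = ν' := by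
  by_contra hne
  have h1 := (inner_lt_one_iff_real_of_norm_eq_one h.1 h'.1).2 hne
  have ht : Tendsto (fun t : ℝ => x + t • (ν' - ν)) (𝓝[>] 0) (𝓝 x) := by
    have : Continuous (fun t : ℝ => x + t • (ν' - ν)) := by fun_prop
    exact (this.tendsto' 0 x (by simp)).mono_left nhdsWithin_le_nhds
  obtain ⟨t, ⟨h2, h3⟩, ht0⟩ :=
    (((ht.eventually h.eventually).and (ht.eventually h'.eventually)).and
      self_mem_nhdsWithin).exists
  have ht0 : 0 < t := ht0
  have h4 := h2.symm.trans h3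
  simp only [add_sub_cancel_left, inner_smul_right, inner_sub_right,
    real_inner_self_eq_norm_sq, h.1, h'.1, real_inner_comm ν ν'] at h4
  rw [real_inner_comm] at h1 h4
  have := h4.1 (by nlinarith)
  nlinarith

lemma normal_eq {x ν : E d} (h : IsOutwardNormal Ω x ν) : normal Ω x = ν := by
  have h' : ∃ ν, IsOutwardNormal Ω x ν := ⟨ν, h⟩
  rw [normal, dif_pos h']
  exact h'.choose_spec.eq h

lemma norm_normal_le (x : E d) : ‖normal Ω x‖ ≤ 1 := by
  by_cases h : ∃ ν, IsOutwardNormal Ω x ν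
  · obtain ⟨ν, h⟩ := h
    rw [normal_eq h, h.1]
  · simp [normal, dif_neg h]

lemma eq_of_mem_face {p q : E d × ℝ} {x : E d} (hp : x ∈ face Ω p) (hq : x ∈ face Ω q) :
    p = q := by
  have h1 : p.1 = q.1 := hp.2.eq hq.2
  have h2 : inner ℝ p.1 x = p.2 := hp.1
  have h3 : inner ℝ q.1 x = q.2 := hq.1
  exact Prod.ext h1 (by rw [← h2, ← h3, h1])

lemma face_subset_frontier (p : E d × ℝ) : face Ω p ⊆ frontier Ω := by
  intro x hx
  have hn := hx.2.1
  have hcont : Continuous (fun t : ℝ => x + t • p.1) := by fun_prop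
  have hev := (hcont.tendsto' 0 x (by simp)).eventually hx.2.eventually
  simp only [add_sub_cancel_left, inner_smul_right, real_inner_self_eq_norm_sq, hn, one_pow,
    mul_one] at hev
  have htend : Tendsto (fun t : ℝ => x + t • p.1) (𝓝 0) (𝓝 x) := hcont.tendsto' 0 x (by simp)
  rw [frontier_eq_closure_inter_closure]
  constructor
  · refine mem_closure_of_tendsto (htend.mono_left nhdsWithin_le_nhds : Tendsto _ (𝓝[<] (0 : ℝ)) _) ?_
    filter_upwards [hev.filter_mono nhdsWithin_le_nhds, self_mem_nhdsWithin] with t ht h0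
    exact ht.2 h0
  · refine mem_closure_of_tendsto (htend.mono_left nhdsWithin_le_nhds : Tendsto _ (𝓝[>] (0 : ℝ)) _) ?_
    filter_upwards [hev.filter_mono nhdsWithin_le_nhds, self_mem_nhdsWithin] with t ht h0
    exact fun hmem => lt_asymm (ht.1 hmem) h0

/-- Faces are relatively open in their hyperplanes. -/
lemma measurableSet_face (p : E d × ℝ) : MeasurableSet (face Ω p) := by
  have hop : ∃ U, IsOpen U ∧ face Ω p = hyperplane p ∩ U := by
    refine ⟨{x | ∃ y ∈ face Ω p, ∃ r > 0, (∀ z ∈ Metric.ball y r,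
      (z ∈ Ω ↔ inner ℝ p.1 (z - y) < 0)) ∧ x ∈ Metric.ball y r}, ?_, ?_⟩
    · rw [isOpen_iff_mem_nhds]
      rintro x ⟨y, hy, r, hr, h, hx⟩
      filter_upwards [Metric.isOpen_ball.mem_nhds hx] with x' hx'
      exact ⟨y, hy, r, hr, h, hx'⟩
    · ext x
      constructor
      · intro hx
        obtain ⟨_, r, hr, h⟩ := hx.2
        exact ⟨hx.1, x, hx, r, hr, h, Metric.mem_ball_self hr⟩
      · rintro ⟨hx, y, hy, r, hr, h, hxy⟩
        obtain ⟨ρ, hρ, hsub⟩ := Metric.isOpen_iff.1 Metric.isOpen_ball x hxy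
        refine ⟨hx, hy.2.1, ρ, hρ, fun z hz => ?_⟩
        rw [h z (hsub hz)]
        -- As x and y lie on the same hyperplane, they define the same half space, so the ball
        -- around y also serves x.
        have h1 : inner ℝ p.1 x = p.2 := hx
        have h2 : inner ℝ p.1 y = p.2 := hy.1
        simp only [inner_sub_right, h1, h2]
  obtain ⟨U, hU, h⟩ := hop
  rw [h]
  exact (isClosed_hyperplane p).measurableSet.inter hU.measurableSet

lemma subset_interior_or_subset_compl_closure {X : Type*} [TopologicalSpace X]
    {s t : Set X} (hs : IsPreconnected s) (h : Disjoint s (frontier t)) :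
    s ⊆ interior t ∨ s ⊆ (closure t)ᶜ := by
  refine isPreconnected_iff_subset_of_disjoint.1 hs _ _ isOpen_interior isClosed_closure.isOpen_compl
    (fun x hx => ?_) ?_
  · by_contra hcon
    simp only [mem_union, mem_compl_iff, not_or, not_not] at hcon
    exact h.le_bot ⟨hx, hcon.2, hcon.1⟩
  · rw [← subset_empty_iff]
    rintro x ⟨_, h1, h2⟩
    exact h2 (subset_closure (interior_subset h1))

/-- Only points of Ω on the dividing hyperplane remain to be excluded: as Ω is open, such a point
could be pushed along ν into the positive half, which misses Ω. -/
lemma isOutwardNormal_of_halves {x ν : E d} {r : ℝ} (hr : 0 < r) (hν : ‖ν‖ = 1)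
    (hneg : ∀ y ∈ Metric.ball x r, inner ℝ ν (y - x) < 0 → y ∈ Ω)
    (hpos : ∀ y ∈ Metric.ball x r, 0 < inner ℝ ν (y - x) → y ∉ closure Ω)
    (hΩ : IsOpen Ω) : IsOutwardNormal Ω x ν := by
  refine ⟨hν, r, hr, fun y hy => ⟨fun hyΩ => ?_, hneg y hy⟩⟩
  by_contra hcon
  have hcont : Continuous (fun t : ℝ => y + t • ν) := by fun_prop
  have htend : Tendsto (fun t : ℝ => y + t • ν) (𝓝[>] 0) (𝓝 y) :=
    (hcont.tendsto' 0 y (by simp)).mono_left nhdsWithin_le_nhds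
  obtain ⟨t, ⟨h1, h2⟩, h3⟩ := (((htend.eventually (hΩ.mem_nhds hyΩ)).and
    (htend.eventually (Metric.isOpen_ball.mem_nhds hy))).and self_mem_nhdsWithin).exists
  refine hpos _ h2 ?_ (subset_closure h1)
  rw [add_sub_right_comm, inner_add_right, inner_smul_right, real_inner_self_eq_norm_sq, hν]
  have h3 : 0 < t := h3
  linarith

/-- Away from the edges, the boundary of a polygonal domain is flat. -/
lemma CoversFrontier.exists_mem_face {P : Finset (E d × ℝ)} (hP : CoversFrontier Ω P)
    (hΩ : IsPolygonalDomain Ω) {x : E d} (hx : x ∈ frontier Ω) (hxe : x ∉ edges P) :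
    ∃ p ∈ P, x ∈ face Ω p := by
  obtain ⟨p, hpP, hp⟩ := hP.frontier_subset x hx
  have hpx : inner ℝ p.1 x = p.2 := hp
  have hp1 := hP.norm_eq_one p hpP
  -- Since x is not on an edge, the boundary in a small ball lies in the hyperplane of p alone. Each
  -- open half ball is convex and misses the boundary, so it is either inside Ω or outside its
  -- closure.
  have hloc : ∀ᶠ y in 𝓝 x, ∀ q ∈ P, q ≠ p ∧ q ≠ -p → y ∉ hyperplane q := by
    rw [Filter.eventually_all_finset]
    intro q hq
    rw [eventually_imp_distrib_left]
    intro hne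
    refine (isClosed_hyperplane q).isOpen_compl.mem_nhds fun hxq => hxe ?_
    simp only [edges, mem_iUnion]
    exact ⟨p, hpP, q, hq, hne, hp, hxq⟩
  obtain ⟨r, hr, hball⟩ := Metric.eventually_nhds_iff_ball.1 hloc
  have hfr : ∀ y ∈ Metric.ball x r, y ∈ frontier Ω → inner ℝ p.1 (y - x) = 0 := by
    intro y hy hyf
    obtain ⟨q, hqP, hq⟩ := hP.frontier_subset y hyf
    have hyp : y ∈ hyperplane p := by
      by_cases h1 : q = p
      · rwa [← h1]
      by_cases h2 : q = -p
      · rwa [h2, hyperplane_neg] at hq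
      exact absurd hq (hball y hy q hqP ⟨h1, h2⟩)
    have : inner ℝ p.1 y = p.2 := hyp
    rw [inner_sub_right, this, hpx, sub_self]
  have hconv (s : Set ℝ) (hs : Convex ℝ s) :
      IsPreconnected (Metric.ball x r ∩ {y | inner ℝ p.1 (y - x) ∈ s}) := by
    refine ((convex_ball x r).inter ?_).isPreconnected
    have : {y | inner ℝ p.1 (y - x) ∈ s} =
        (fun y => -x + y) ⁻¹' ((innerSL ℝ p.1 : E d →ₗ[ℝ] ℝ) ⁻¹' s) := by
      ext y; simp [sub_eq_neg_add]
    rw [this]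
    exact (hs.linear_preimage _).translate_preimage_right _
  have hint : interior Ω = Ω := hΩ.isOpen.interior_eq
  have hhalf (s : Set ℝ) (hs : Convex ℝ s) (h0 : (0 : ℝ) ∉ s) :=
    subset_interior_or_subset_compl_closure (t := Ω) (hconv s hs) (by
      rw [Set.disjoint_left]
      rintro y ⟨hy, hys⟩ hyf
      rw [mem_ofPred_eq, hfr y hy hyf] at hys
      exact h0 hys)
  rw [hint] at hhalf
  have hxcl : x ∈ closure Ω := frontier_subset_closure hx
  have hxΩ : x ∉ Ω := fun h => (hint ▸ hx.2) h
  have hxball := Metric.ball_mem_nhds x hr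
  rcases hhalf (Iio 0) (convex_Iio _) (by simp) with hn | hn <;>
    rcases hhalf (Ioi 0) (convex_Ioi _) (by simp) with hq | hq
  -- Both halves in Ω: then the whole ball lies in the closure of Ω, so x is interior to the
  -- closure, which is Ω itself. This is where slits are ruled out.
  · exfalso
    apply hxΩ
    rw [← hΩ.interior_closure, mem_interior_iff_mem_nhds]
    filter_upwards [hxball] with y hy
    by_contra hycl
    have hyi : inner ℝ p.1 (y - x) = 0 := by
      by_contra hne
      rcases lt_or_gt_of_ne hne with h | h
      · exact hycl (subset_closure (hn ⟨hy, h⟩))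
      · exact hycl (subset_closure (hq ⟨hy, h⟩))
    have hcont : Continuous (fun t : ℝ => y + t • p.1) := by fun_prop
    have htend : Tendsto (fun t : ℝ => y + t • p.1) (𝓝[>] 0) (𝓝 y) :=
      (hcont.tendsto' 0 y (by simp)).mono_left nhdsWithin_le_nhds
    refine hycl (closure_closure (s := Ω) ▸ mem_closure_of_tendsto htend ?_)
    filter_upwards [htend.eventually (Metric.isOpen_ball.mem_nhds hy), self_mem_nhdsWithin]
      with t h1 h2
    refine subset_closure (hq ⟨h1, ?_⟩)
    have h2 : 0 < t := h2
    rw [mem_ofPred_eq, add_sub_right_comm, inner_add_right, inner_smul_right, hyi,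
      real_inner_self_eq_norm_sq, hp1, mem_Ioi]
    linarith
  · exact ⟨p, hpP, hp, isOutwardNormal_of_halves hr hp1 (fun y hy h => hn ⟨hy, h⟩)
      (fun y hy h => hq ⟨hy, h⟩) hΩ.isOpen⟩
  · refine ⟨-p, hP.neg_mem p hpP, (hyperplane_neg p).symm ▸ hp,
      isOutwardNormal_of_halves hr (by simpa using hp1) (fun y hy h => hq ⟨hy, ?_⟩)
        (fun y hy h => hn ⟨hy, ?_⟩) hΩ.isOpen⟩
    · simpa using h
    · simpa using h
  -- Both halves outside the closure: then Ω meets the ball only inside a hyperplane, impossible for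
  -- a nonempty open set.
  · exfalso
    obtain ⟨y, hy, hyΩ⟩ := mem_closure_iff_nhds.1 hxcl _ hxball
    obtain ⟨ρ, hρ, hsub⟩ := Metric.isOpen_iff.1 (Metric.isOpen_ball.inter hΩ.isOpen) y ⟨hy, hyΩ⟩
    have hyi : inner ℝ p.1 (y - x) = 0 := by
      by_contra hne
      rcases lt_or_gt_of_ne hne with h | h
      · exact hn ⟨hy, h⟩ (subset_closure hyΩ)
      · exact hq ⟨hy, h⟩ (subset_closure hyΩ)
    have hmem : y + (ρ / 2) • p.1 ∈ Metric.ball y ρ := by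
      simp [norm_smul, hp1, abs_of_pos hρ, hρ]
    have h1 := hsub hmem
    refine hq ⟨h1.1, ?_⟩ (subset_closure h1.2)
    rw [mem_ofPred_eq, add_sub_right_comm, inner_add_right, inner_smul_right, hyi,
      real_inner_self_eq_norm_sq, hp1, mem_Ioi]
    linarith

end Faces

variable {m : ℕ} {Ω : Set (E (m + 1))} {P : Finset (E (m + 1) × ℝ)}

/-! ### The surface measure -/

/-- In a chart of one hyperplane, each other hyperplane, not equal to it up to orientation, leaves a
Lebesgue null trace. -/
lemma CoversFrontier.euclideanHausdorffMeasure_edges (hP : CoversFrontier Ω P) :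
    Measure.euclideanHausdorffMeasure m (edges P) = 0 := by
  simp only [edges]
  refine (measure_biUnion_null_iff P.countable_toSet).2 fun p hp =>
    (measure_biUnion_null_iff P.countable_toSet).2 fun q hq => measure_iUnion_null fun hne => ?_
  obtain ⟨B, hB⟩ := exists_isHyperplaneChart (hP.norm_eq_one p hp)
  rw [inter_comm, ← Measure.restrict_apply (isClosed_hyperplane q).measurableSet]
  change (Measure.euclideanHausdorffMeasure m).restrict {x | inner ℝ p.1 x = p.2} _ = 0
  rw [← hB.map_volume p.2, Measure.map_apply (by fun_prop) (isClosed_hyperplane q).measurableSet]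
  exact volume_chart_preimage_hyperplane hB (hP.norm_eq_one q hq) hne.1 hne.2

lemma CoversFrontier.frontier_ae_eq (hP : CoversFrontier Ω P) (hΩ : IsPolygonalDomain Ω) :
    frontier Ω =ᵐ[Measure.euclideanHausdorffMeasure m] ⋃ p ∈ P, face Ω p := by
  have h0 : ∀ᵐ x ∂(Measure.euclideanHausdorffMeasure m : Measure (E (m + 1))), x ∉ edges P :=
    measure_eq_zero_iff_ae_notMem.1 hP.euclideanHausdorffMeasure_edges
  refine Filter.eventuallyEq_set.2 ?_
  filter_upwards [h0] with x hx
  simp only [mem_iUnion, exists_prop]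
  exact ⟨fun h => hP.exists_mem_face hΩ h hx, fun ⟨p, _, h⟩ => face_subset_frontier p h⟩

lemma CoversFrontier.surf_eq (hP : CoversFrontier Ω P) (hΩ : IsPolygonalDomain Ω) :
    surf Ω = (Measure.euclideanHausdorffMeasure m).restrict (⋃ p ∈ P, face Ω p) :=
  Measure.restrict_congr_set (hP.frontier_ae_eq hΩ)

lemma euclideanHausdorffMeasure_hyperplane_inter_lt_top {p : E (m + 1) × ℝ} (hp : ‖p.1‖ = 1)
    {s : Set (E (m + 1))} (hs : Bornology.IsBounded s) (hms : MeasurableSet s) :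
    Measure.euclideanHausdorffMeasure m (s ∩ hyperplane p) < ⊤ := by
  obtain ⟨B, hB⟩ := exists_isHyperplaneChart hp
  rw [← Measure.restrict_apply hms]
  simp only [hyperplane]
  rw [← hB.map_volume p.2, Measure.map_apply (by fun_prop) hms]
  exact ((IsHyperplaneChart.isometry B p.1 p.2).antilipschitz.isBounded_preimage
    hs).measure_lt_top

lemma IsPolygonalDomain.isFiniteMeasure_surf (hΩ : IsPolygonalDomain Ω) :
    IsFiniteMeasure (surf Ω) := by
  obtain ⟨P, hP⟩ := hΩ.exists_coversFrontier
  constructor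
  rw [surf, Measure.restrict_apply_univ]
  have hsub : frontier Ω ⊆ ⋃ p ∈ P, frontier Ω ∩ hyperplane p := by
    intro x hx
    obtain ⟨p, hp, hxp⟩ := hP.frontier_subset x hx
    exact mem_biUnion hp ⟨hx, hxp⟩
  refine (measure_mono hsub).trans_lt ((measure_biUnion_finset_le _ _).trans_lt ?_)
  refine ENNReal.sum_lt_top.2 fun p hp => ?_
  exact euclideanHausdorffMeasure_hyperplane_inter_lt_top (hP.norm_eq_one p hp)
    (hΩ.isBounded.closure.subset frontier_subset_closure) isClosed_frontier.measurableSet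

lemma IsPolygonalDomain.ae_exists_mem_face (hP : CoversFrontier Ω P) (hΩ : IsPolygonalDomain Ω) :
    ∀ᵐ x ∂(surf Ω), ∃ p ∈ P, x ∈ face Ω p := by
  rw [hP.surf_eq hΩ]
  have hm : MeasurableSet (⋃ p ∈ P, face Ω p) :=
    P.measurableSet_biUnion fun p _ => measurableSet_face p
  filter_upwards [ae_restrict_mem hm] with x hx
  simpa using hx

lemma IsPolygonalDomain.aestronglyMeasurable_normal (hΩ : IsPolygonalDomain Ω) (i : Fin (m + 1)) :
    AEStronglyMeasurable (fun x => normal Ω x i) (surf Ω) := by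
  obtain ⟨P, hP⟩ := hΩ.exists_coversFrontier
  -- The normal is defined by choice, but off the edges it equals this step function: each such
  -- boundary point lies on exactly one face.
  have hm : Measurable (fun x => ∑ p ∈ P, (face Ω p).indicator (fun _ => p.1 i) x) :=
    Finset.measurable_sum _ fun p _ => measurable_const.indicator (measurableSet_face p)
  refine ⟨_, hm.stronglyMeasurable, ?_⟩
  filter_upwards [IsPolygonalDomain.ae_exists_mem_face hP hΩ] with x ⟨p, hp, hx⟩
  rw [normal_eq hx.2, Finset.sum_eq_single p, indicator_of_mem hx]
  · intro q _ hne
    exact indicator_of_notMem (fun h => hne (eq_of_mem_face h hx)) _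
  · exact fun h => absurd hp h

lemma IsPolygonalDomain.integrable_mul_normal (hΩ : IsPolygonalDomain Ω) {f : E (m + 1) → ℝ}
    (hf : Integrable f (surf Ω)) (i : Fin (m + 1)) :
    Integrable (fun x => f x * normal Ω x i) (surf Ω) := by
  refine hf.mul_bdd (c := 1) (hΩ.aestronglyMeasurable_normal i) (Eventually.of_forall fun x => ?_)
  exact (PiLp.norm_apply_le (normal Ω x) i).trans (norm_normal_le x)

/-- The faces are disjoint, because the normal at a point is unique, and the normal is constant on
each of them. -/
lemma CoversFrontier.integral_mul_inner_normal (hP : CoversFrontier Ω P) (hΩ : IsPolygonalDomain Ω)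
    {f : E (m + 1) → ℝ} (e : E (m + 1))
    (hf : Integrable (fun x => f x * inner ℝ (normal Ω x) e) (surf Ω)) :
    ∫ x, f x * inner ℝ (normal Ω x) e ∂(surf Ω) = ∑ p ∈ P, inner ℝ p.1 e *
      ∫ x in face Ω p, f x ∂(Measure.euclideanHausdorffMeasure m) := by
  rw [hP.surf_eq hΩ] at hf ⊢
  rw [integral_biUnion_finset _ (fun p _ => measurableSet_face p)]
  · refine Finset.sum_congr rfl fun p _ => ?_
    rw [← integral_const_mul]
    refine setIntegral_congr_fun (measurableSet_face p) fun x hx => ?_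
    rw [normal_eq hx.2, mul_comm]
  · intro p _ q _ hne
    exact Set.disjoint_left.2 fun x h1 h2 => hne (eq_of_mem_face h1 h2)
  · intro p hp
    exact IntegrableOn.mono_set hf (subset_biUnion_of_mem (u := fun p => face Ω p) hp)

lemma setIntegral_face {p : E (m + 1) × ℝ} {B : E m →ₗᵢ[ℝ] E (m + 1)}
    (hB : IsHyperplaneChart p.1 B) {f : E (m + 1) → ℝ} (hf : Continuous f) :
    ∫ x in face Ω p, f x ∂(Measure.euclideanHausdorffMeasure m) =
      ∫ y in (fun y => p.2 • p.1 + B y) ⁻¹' face Ω p, f (p.2 • p.1 + B y) := by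
  have h1 : (Measure.euclideanHausdorffMeasure m : Measure (E (m + 1))).restrict (face Ω p) =
      ((Measure.euclideanHausdorffMeasure m).restrict (hyperplane p)).restrict (face Ω p) := by
    rw [Measure.restrict_restrict (measurableSet_face p), inter_eq_left.2 (fun x hx => hx.1)]
  rw [h1]
  simp only [hyperplane]
  rw [← hB.map_volume p.2, setIntegral_map (measurableSet_face p) hf.aestronglyMeasurable
    (by fun_prop)]

/-! ### Lines in a given direction -/

/-- The time at which the line `s ↦ x + s • e` meets the hyperplane `p`. -/
noncomputable def hitTime (e : E (m + 1)) (p : E (m + 1) × ℝ) (x : E (m + 1)) : ℝ :=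
  (p.2 - inner ℝ p.1 x) / inner ℝ p.1 e

lemma hitTime_add_smul {e : E (m + 1)} {p : E (m + 1) × ℝ} (he : inner ℝ p.1 e ≠ 0)
    (x : E (m + 1)) (s : ℝ) : hitTime e p (x + s • e) = hitTime e p x - s := by
  simp only [hitTime, inner_add_right, inner_smul_right]
  field_simp
  ring

lemma hitTime_eq {e : E (m + 1)} {p : E (m + 1) × ℝ} (he : inner ℝ p.1 e ≠ 0)
    {x : E (m + 1)} {s : ℝ} (h : x + s • e ∈ hyperplane p) : hitTime e p x = s := by
  have h : inner ℝ p.1 (x + s • e) = p.2 := h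
  rw [inner_add_right, inner_smul_right] at h
  rw [hitTime, div_eq_iff he, ← h]
  ring

@[fun_prop]
lemma continuous_hitTime (e : E (m + 1)) (p : E (m + 1) × ℝ) : Continuous (hitTime e p) := by
  unfold hitTime
  exact (by fun_prop : Continuous fun x => p.2 - inner ℝ p.1 x).div_const _

/-- Almost every line in direction `e` avoids the edges and is not contained in a hyperplane. -/
lemma CoversFrontier.ae_line (hP : CoversFrontier Ω P) (e : E (m + 1)) :
    ∀ᵐ x : E (m + 1), (∀ p ∈ P, x ∉ hyperplane p) ∧ ∀ s : ℝ, x + s • e ∉ edges P := by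
  have h1 : ∀ᵐ x : E (m + 1), ∀ p ∈ P, x ∉ hyperplane p := by
    rw [Filter.eventually_all_finset]
    exact fun p hp => measure_eq_zero_iff_ae_notMem.1 (volume_hyperplane (hP.norm_eq_one p hp) p.2)
  have h2 : ∀ᵐ x : E (m + 1), ∀ p ∈ P, ∀ q ∈ P, (q ≠ p ∧ q ≠ -p) → inner ℝ p.1 e ≠ 0 →
      x + hitTime e p x • e ∉ hyperplane q := by
    rw [Filter.eventually_all_finset]
    intro p hp
    rw [Filter.eventually_all_finset]
    intro q hq
    rw [eventually_imp_distrib_left]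
    intro hne
    rw [eventually_imp_distrib_left]
    intro he
    obtain ⟨B, hB⟩ := exists_isHyperplaneChart (hP.norm_eq_one p hp)
    have hmp := hB.measurePreserving_oblique p.2 he
    have hmeas : MeasurableSet {x | x + hitTime e p x • e ∈ hyperplane q} :=
      ((isClosed_hyperplane q).preimage (by fun_prop)).measurableSet
    refine measure_eq_zero_iff_ae_notMem.1 (?_ : volume {x | x + hitTime e p x • e ∈ hyperplane q} = 0)
    rw [← hmp.measure_preimage hmeas.nullMeasurableSet]
    -- The point where a line meets p does not depend on the starting point on that line. In oblique
    -- coordinates the bad set is therefore ℝ times a null set of the chart.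
    have hpre : (fun z : ℝ × E m => p.2 • p.1 + B z.2 + z.1 • e) ⁻¹'
        {x | x + hitTime e p x • e ∈ hyperplane q} =
        univ ×ˢ ((fun y => p.2 • p.1 + B y) ⁻¹' {x | inner ℝ q.1 x = q.2}) := by
      ext ⟨s, y⟩
      have : p.2 • p.1 + B y + (0 : ℝ) • e ∈ hyperplane p := by
        have := hB.range_eq p.2 ▸ mem_range_self y
        simpa [hyperplane] using this
      simp only [mem_preimage, mem_ofPred_eq, hitTime_add_smul he, hitTime_eq he this, mem_prod,
        mem_univ, true_and, zero_sub, neg_smul, add_neg_cancel_right, hyperplane]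
    rw [hpre, Measure.smul_apply, Measure.prod_prod,
      volume_chart_preimage_hyperplane hB (hP.norm_eq_one q hq) hne.1 hne.2]
    simp
  filter_upwards [h1, h2] with x hx1 hx2
  refine ⟨hx1, fun s hs => ?_⟩
  simp only [edges, mem_iUnion] at hs
  obtain ⟨p, hp, q, hq, hne, hsp, hsq⟩ := hs
  by_cases he : inner ℝ p.1 e = 0
  · refine hx1 p hp ?_
    have hsp : inner ℝ p.1 (x + s • e) = p.2 := hsp
    rw [inner_add_right, inner_smul_right, he, mul_zero, add_zero] at hsp
    exact hsp
  · refine hx2 p hp q hq hne he ?_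
    rwa [hitTime_eq he hsp]

open Classical in
/-- The signed number of crossings of the face `p` by the ray `s ↦ x + s • e`, `s > 0`: it is `1` if
the ray leaves `Ω` there, and `-1` if it enters `Ω`. -/
noncomputable def crossing (Ω : Set (E (m + 1))) (e : E (m + 1)) (p : E (m + 1) × ℝ)
    (x : E (m + 1)) : ℝ :=
  if x + hitTime e p x • e ∈ face Ω p then
    if 0 < inner ℝ p.1 e then (if 0 < hitTime e p x then 1 else 0)
    else (if 0 ≤ hitTime e p x then -1 else 0)
  else 0

lemma crossing_of_neg {e : E (m + 1)} {p : E (m + 1) × ℝ} {x : E (m + 1)}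
    (h : hitTime e p x < 0) : crossing Ω e p x = 0 := by
  simp [crossing, h.not_gt, h.not_ge]

lemma measurable_crossing (e : E (m + 1)) (p : E (m + 1) × ℝ) :
    Measurable (crossing Ω e p) := by
  unfold crossing
  refine Measurable.ite ?_ ?_ measurable_const
  · exact measurableSet_preimage (by fun_prop) (measurableSet_face p)
  · split_ifs
    · exact Measurable.ite (measurableSet_lt measurable_const (by fun_prop)) measurable_const
        measurable_const
    · exact Measurable.ite (measurableSet_le measurable_const (by fun_prop)) measurable_const
        measurable_const

lemma abs_crossing_le (e : E (m + 1)) (p : E (m + 1) × ℝ) (x : E (m + 1)) :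
    |crossing Ω e p x| ≤ 1 := by
  unfold crossing
  split_ifs <;> simp

open Classical in
-- All points of a line share one hitting point, so along the line the crossing number is a step
-- function with its only possible jump at the hitting time.
lemma crossing_add_smul {e : E (m + 1)} {p : E (m + 1) × ℝ} (he : inner ℝ p.1 e ≠ 0)
    (x : E (m + 1)) (s : ℝ) : crossing Ω e p (x + s • e) =
      if x + hitTime e p x • e ∈ face Ω p then
        if 0 < inner ℝ p.1 e then (if s < hitTime e p x then 1 else 0)
        else (if s ≤ hitTime e p x then -1 else 0)
      else 0 := by
  have hpt : x + s • e + hitTime e p (x + s • e) • e = x + hitTime e p x • e := by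
    rw [hitTime_add_smul he, add_assoc, ← add_smul, add_sub_cancel]
  unfold crossing
  rw [hpt, hitTime_add_smul he]
  simp only [sub_pos, sub_nonneg]

lemma crossing_eventually_const {e : E (m + 1)} {p : E (m + 1) × ℝ} {x : E (m + 1)}
    (he : inner ℝ p.1 e ≠ 0) {s₀ : ℝ} (h : x + s₀ • e ∉ face Ω p) :
    ∀ᶠ s in 𝓝 s₀, crossing Ω e p (x + s • e) = crossing Ω e p (x + s₀ • e) := by
  simp only [crossing_add_smul he]
  by_cases hf : x + hitTime e p x • e ∈ face Ω p
  · have hne : hitTime e p x ≠ s₀ := by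
      rintro rfl
      exact h hf
    rcases lt_or_gt_of_ne hne with h' | h'
    · filter_upwards [lt_mem_nhds h'] with s hs
      simp [hs.not_gt, hs.not_ge, h'.not_gt, h'.not_ge]
    · filter_upwards [gt_mem_nhds h'] with s hs
      simp [hs, hs.le, h', h'.le]
  · simp [hf]

lemma crossing_of_inner_eq_zero {e : E (m + 1)} {p : E (m + 1) × ℝ} {x : E (m + 1)}
    (he : inner ℝ p.1 e = 0) (hx : x ∉ hyperplane p) : crossing Ω e p x = 0 := by
  have h : x ∉ face Ω p := fun h => hx h.1
  simp [crossing, hitTime, he, h]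

/-- A point lies in `Ω` iff the ray from it leaves `Ω` once more than it enters `Ω`. -/
lemma CoversFrontier.indicator_eq_sum_crossing (hP : CoversFrontier Ω P)
    (hΩ : IsPolygonalDomain Ω) {e x : E (m + 1)} (he : e ≠ 0)
    (hx : (∀ p ∈ P, x ∉ hyperplane p) ∧ ∀ s : ℝ, x + s • e ∉ edges P) :
    Ω.indicator 1 x = ∑ p ∈ P, crossing Ω e p x := by
  classical
  -- The difference of the two sides along the line is locally constant in s and vanishes for large
  -- s because Ω is bounded; so it is zero at s = 0.
  set h : ℝ → ℝ := fun s => Ω.indicator 1 (x + s • e) - ∑ p ∈ P, crossing Ω e p (x + s • e)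
    with hh
  have hpar : ∀ p ∈ P, inner ℝ p.1 e = 0 → ∀ s : ℝ, x + s • e ∉ hyperplane p := by
    intro p hp h0 s hs
    refine hx.1 p hp ?_
    have hs : inner ℝ p.1 (x + s • e) = p.2 := hs
    rw [inner_add_right, inner_smul_right, h0, mul_zero, add_zero] at hs
    exact hs
  have hcont : Continuous fun s : ℝ => x + s • e := by fun_prop
  have hconst : ∀ p ∈ P, ∀ s₀ : ℝ, x + s₀ • e ∉ face Ω p →
      ∀ᶠ s in 𝓝 s₀, crossing Ω e p (x + s • e) = crossing Ω e p (x + s₀ • e) := by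
    intro p hp s₀ hs₀
    by_cases h0 : inner ℝ p.1 e = 0
    · refine Eventually.of_forall fun s => ?_
      rw [crossing_of_inner_eq_zero h0 (hpar p hp h0 s),
        crossing_of_inner_eq_zero h0 (hpar p hp h0 s₀)]
    · exact crossing_eventually_const h0 hs₀
  have hloc : IsLocallyConstant h := by
    rw [IsLocallyConstant.iff_eventually_eq]
    intro s₀
    by_cases hfr : x + s₀ • e ∈ frontier Ω
    · obtain ⟨p, hp, hpf⟩ := hP.exists_mem_face hΩ hfr (hx.2 s₀)
      have h0 : inner ℝ p.1 e ≠ 0 := fun h0 => hpar p hp h0 s₀ hpf.1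
      have hothers : ∀ᶠ s in 𝓝 s₀, ∀ q ∈ P.erase p,
          crossing Ω e q (x + s • e) = crossing Ω e q (x + s₀ • e) := by
        rw [Filter.eventually_all_finset]
        intro q hq
        exact hconst q (Finset.mem_of_mem_erase hq) s₀
          fun hqf => Finset.ne_of_mem_erase hq (eq_of_mem_face hqf hpf)
      have hΩev := (hcont.tendsto s₀).eventually hpf.2.eventually
      -- The jumps cancel. The strict inequality at exits and the weak one at entries in `crossing`
      -- make this hold at s₀ too, where the indicator is 0 because Ω is open.
      have key : ∀ s : ℝ, (x + s • e ∈ Ω ↔ inner ℝ p.1 (x + s • e - (x + s₀ • e)) < 0) →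
          Ω.indicator (1 : E (m + 1) → ℝ) (x + s • e) - crossing Ω e p (x + s • e) =
            if 0 < inner ℝ p.1 e then 0 else 1 := by
        intro s hs
        have hht : hitTime e p x = s₀ := hitTime_eq h0 hpf.1
        rw [add_sub_add_left_eq_sub, ← sub_smul, inner_smul_right] at hs
        rw [crossing_add_smul h0, hht, if_pos hpf]
        simp only [indicator_apply, hs, Pi.one_apply]
        rcases lt_or_gt_of_ne h0 with hneg | hpos
        · rcases le_or_gt s s₀ with hle | hgt
          · have h1 : ¬ (s - s₀) * inner ℝ p.1 e < 0 := by
              have := mul_nonneg_of_nonpos_of_nonpos (sub_nonpos.2 hle) hneg.le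
              exact not_lt.2 this
            simp [h1, hneg.not_gt, hle]
          · have h1 : (s - s₀) * inner ℝ p.1 e < 0 := mul_neg_of_pos_of_neg (sub_pos.2 hgt) hneg
            simp [h1, hneg.not_gt, hgt]
        · rcases lt_or_ge s s₀ with hlt | hge
          · have h1 : (s - s₀) * inner ℝ p.1 e < 0 := mul_neg_of_neg_of_pos (sub_neg.2 hlt) hpos
            simp [h1, hpos, hlt]
          · have h1 : ¬ (s - s₀) * inner ℝ p.1 e < 0 :=
              not_lt.2 (mul_nonneg (sub_nonneg.2 hge) hpos.le)
            simp [h1, hpos, hge]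
      filter_upwards [hothers, hΩev] with s hs1 hs2
      simp only [hh]
      rw [← Finset.add_sum_erase P _ hp, ← Finset.add_sum_erase P _ hp, Finset.sum_congr rfl hs1,
        ← sub_sub, ← sub_sub, key s hs2, key s₀ hpf.2.eventually.self_of_nhds]
    · have hall : ∀ᶠ s in 𝓝 s₀, ∀ p ∈ P,
          crossing Ω e p (x + s • e) = crossing Ω e p (x + s₀ • e) := by
        rw [Filter.eventually_all_finset]
        exact fun p hp => hconst p hp s₀ fun hpf => hfr (face_subset_frontier p hpf)
      have hΩev : ∀ᶠ s in 𝓝 s₀, (x + s • e ∈ Ω ↔ x + s₀ • e ∈ Ω) := by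
        by_cases hmem : x + s₀ • e ∈ Ω
        · filter_upwards [(hcont.tendsto s₀).eventually (hΩ.isOpen.mem_nhds hmem)] with s hs
          exact iff_of_true hs hmem
        · have hcl : x + s₀ • e ∈ (closure Ω)ᶜ := by
            intro hcl
            rw [hΩ.isOpen.frontier_eq] at hfr
            exact hfr ⟨hcl, hmem⟩
          filter_upwards [(hcont.tendsto s₀).eventually
            (isClosed_closure.isOpen_compl.mem_nhds hcl)] with s hs
          exact iff_of_false (fun hs' => hs (subset_closure hs')) hmem
      filter_upwards [hall, hΩev] with s hs1 hs2
      simp only [hh]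
      rw [Finset.sum_congr rfl hs1]
      simp only [indicator_apply, hs2, Pi.one_apply]
  have hlim : ∀ᶠ s in atTop, h s = 0 := by
    have h1 : ∀ᶠ s : ℝ in atTop, ∀ p ∈ P, crossing Ω e p (x + s • e) = 0 := by
      rw [Filter.eventually_all_finset]
      intro p hp
      by_cases h0 : inner ℝ p.1 e = 0
      · exact Eventually.of_forall fun s => crossing_of_inner_eq_zero h0 (hpar p hp h0 s)
      · filter_upwards [eventually_gt_atTop (hitTime e p x)] with s hs
        exact crossing_of_neg (by rw [hitTime_add_smul h0]; linarith)
    have h2 : ∀ᶠ s : ℝ in atTop, x + s • e ∉ Ω := by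
      obtain ⟨R, hR⟩ := hΩ.isBounded.exists_norm_le
      have he' : 0 < ‖e‖ := norm_pos_iff.2 he
      filter_upwards [eventually_gt_atTop ((R + ‖x‖) / ‖e‖), eventually_ge_atTop 0] with s hs hs0 hmem
      have h3 := hR _ hmem
      rw [div_lt_iff₀ he'] at hs
      have h4 : ‖s • e‖ ≤ ‖x + s • e‖ + ‖x‖ := by
        simpa using norm_sub_le (x + s • e) x
      rw [norm_smul, Real.norm_of_nonneg hs0] at h4
      linarith
    filter_upwards [h1, h2] with s hs1 hs2
    simp only [hh]
    rw [Finset.sum_eq_zero hs1, indicator_of_notMem hs2, sub_zero]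
  obtain ⟨s, hs⟩ := hlim.exists
  have h0 : h 0 = 0 := (hloc.apply_eq_of_preconnectedSpace 0 s).trans hs
  simp only [hh, zero_smul, add_zero] at h0
  exact sub_eq_zero.1 h0

/-! ### The divergence theorem -/

lemma integral_oblique {p : E (m + 1) × ℝ} {B : E m →ₗᵢ[ℝ] E (m + 1)}
    (hB : IsHyperplaneChart p.1 B) {e : E (m + 1)} (he : inner ℝ p.1 e ≠ 0) {f : E (m + 1) → ℝ}
    (hf : Integrable f) :
    ∫ x, f x = |inner ℝ p.1 e| * ∫ y, ∫ s : ℝ, f (p.2 • p.1 + B y + s • e) := by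
  have hmp := hB.measurePreserving_oblique p.2 he
  have hint := hmp.integrable_comp_of_integrable hf
  have hc : ENNReal.ofReal |inner ℝ p.1 e| ≠ 0 := by simpa using he
  rw [integrable_smul_measure hc ENNReal.ofReal_ne_top] at hint
  rw [← hmp.map_eq, integral_map hmp.measurable.aemeasurable
    (by rw [hmp.map_eq]; exact hf.aestronglyMeasurable), integral_smul_measure,
    ENNReal.toReal_ofReal (abs_nonneg _), smul_eq_mul]
  exact congrArg _ (integral_prod_symm _ hint)

/-- This is the fundamental theorem of calculus on a half line; e ≠ 0 embeds the line as a closed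
set, so w stays compactly supported along it. -/
lemma integral_Iic_fderiv_line {F : Type*} [NormedAddCommGroup F] [NormedSpace ℝ F] {w : F → ℝ}
    (hw : ContDiff ℝ 1 w) (hc : HasCompactSupport w) {e : F} (he : e ≠ 0) (z : F) :
    ∫ s in Iic (0 : ℝ), fderiv ℝ w (z + s • e) e = w z := by
  have h1 : ContDiff ℝ 1 (fun s : ℝ => w (z + s • e)) := by fun_prop
  have h2 : HasCompactSupport (fun s : ℝ => w (z + s • e)) :=
    hc.comp_isClosedEmbedding
      ((Homeomorph.addLeft z).isClosedEmbedding.comp (isClosedEmbedding_smul_left he))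
  have h3 := h2.integral_Iic_deriv_eq h1 0
  rw [zero_smul, add_zero] at h3
  rw [← h3]
  refine integral_congr_ae (Eventually.of_forall fun s => ?_)
  have h4 : HasDerivAt (fun s : ℝ => z + s • e) e s := by
    simpa using ((hasDerivAt_id s).smul_const e).const_add z
  exact (((hw.differentiable one_ne_zero _).hasFDerivAt.comp_hasDerivAt s h4).deriv).symm

/-- In oblique coordinates based on p every line meets p at s = 0. If the meeting point is on the
face, the crossing number is the sign of ⟪ν, e⟫ on the half line s < 0, where ν is the unit vector
of p, and the inner integral is that sign times w there. The Jacobian |⟪ν, e⟫| restores the factor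
⟪ν, e⟫. -/
lemma integral_crossing_mul_fderiv {w : E (m + 1) → ℝ} (hw : ContDiff ℝ 1 w)
    (hc : HasCompactSupport w) {e : E (m + 1)} (he : e ≠ 0) {p : E (m + 1) × ℝ} (hp : ‖p.1‖ = 1) :
    ∫ x, crossing Ω e p x * fderiv ℝ w x e =
      inner ℝ p.1 e * ∫ x in face Ω p, w x ∂(Measure.euclideanHausdorffMeasure m) := by
  by_cases h0 : inner ℝ p.1 e = 0
  · rw [h0, zero_mul]
    refine integral_eq_zero_of_ae ?_
    filter_upwards [measure_eq_zero_iff_ae_notMem.1 (volume_hyperplane hp p.2)] with x hx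
    rw [crossing_of_inner_eq_zero h0 hx, zero_mul, Pi.zero_apply]
  obtain ⟨B, hB⟩ := exists_isHyperplaneChart hp
  have hint : Integrable (fun x => crossing Ω e p x * fderiv ℝ w x e) := by
    have h1 : Integrable (fun x => fderiv ℝ w x e) :=
      ((hw.continuous_fderiv one_ne_zero).clm_apply continuous_const).integrable_of_hasCompactSupport
        (hc.fderiv_apply (𝕜 := ℝ) e)
    exact h1.bdd_mul (c := 1) (measurable_crossing e p).aestronglyMeasurable
      (Eventually.of_forall fun x => abs_crossing_le e p x)
  have hmem (y : E m) : p.2 • p.1 + B y ∈ hyperplane p := by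
    have : p.2 • p.1 + B y ∈ range (fun y => p.2 • p.1 + B y) := mem_range_self y
    rwa [hB.range_eq p.2] at this
  have hht (y : E m) : hitTime e p (p.2 • p.1 + B y) = 0 :=
    hitTime_eq h0 (by simpa using hmem y)
  have hms : MeasurableSet ((fun y => p.2 • p.1 + B y) ⁻¹' face Ω p) :=
    measurableSet_preimage (by fun_prop) (measurableSet_face p)
  rw [integral_oblique hB h0 hint, setIntegral_face hB hw.continuous, ← integral_indicator hms,
    ← integral_const_mul, ← integral_const_mul]
  congr 1
  ext y
  have hpt : p.2 • p.1 + B y + hitTime e p (p.2 • p.1 + B y) • e = p.2 • p.1 + B y := by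
    rw [hht, zero_smul, add_zero]
  by_cases hf : p.2 • p.1 + B y ∈ face Ω p
  · rw [indicator_of_mem (by exact hf), ← integral_Iic_fderiv_line hw hc he]
    simp only [crossing_add_smul h0, hht, if_pos (hpt.symm ▸ hf)]
    rcases lt_or_gt_of_ne h0 with hneg | hpos
    · simp only [hneg.not_gt, if_false, abs_of_neg hneg, neg_mul, ← mul_neg, ← integral_neg]
      rw [← integral_indicator measurableSet_Iic]
      congr 2
      ext s
      by_cases hs : s ≤ 0 <;> simp [hs]
    · simp only [hpos, if_true, abs_of_pos hpos]
      rw [integral_Iic_eq_integral_Iio, ← integral_indicator measurableSet_Iio]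
      congr 2
      ext s
      by_cases hs : s < 0 <;> simp [hs]
  · rw [indicator_of_notMem (by exact hf)]
    simp only [crossing_add_smul h0, if_neg (hpt.symm ▸ hf), zero_mul, integral_zero, mul_zero]

/-- The divergence theorem on a polygonal domain, for compactly supported functions. -/
theorem IsPolygonalDomain.setIntegral_fderiv (hΩ : IsPolygonalDomain Ω) {w : E (m + 1) → ℝ}
    (hw : ContDiff ℝ 1 w) (hc : HasCompactSupport w) (e : E (m + 1)) :
    ∫ x in Ω, fderiv ℝ w x e = ∫ x, w x * inner ℝ (normal Ω x) e ∂(surf Ω) := by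
  obtain rfl | he := eq_or_ne e 0
  · simp
  obtain ⟨P, hP⟩ := hΩ.exists_coversFrontier
  have := hΩ.isFiniteMeasure_surf
  have hg : Integrable (fun x => fderiv ℝ w x e) :=
    ((hw.continuous_fderiv one_ne_zero).clm_apply continuous_const).integrable_of_hasCompactSupport
      (hc.fderiv_apply (𝕜 := ℝ) e)
  have hwint : Integrable w (surf Ω) := hw.continuous.integrable_of_hasCompactSupport hc
  have hb : Integrable (fun x => w x * inner ℝ (normal Ω x) e) (surf Ω) := by
    have h1 : Integrable (fun x => ∑ i, e i * (w x * normal Ω x i)) (surf Ω) :=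
      integrable_finsetSum _ fun i _ => (hΩ.integrable_mul_normal hwint i).const_mul _
    refine h1.congr (Eventually.of_forall fun x => ?_)
    simp only [PiLp.inner_apply, Finset.mul_sum]
    refine Finset.sum_congr rfl fun i _ => ?_
    simp
    ring
  rw [hP.integral_mul_inner_normal hΩ e hb, ← integral_indicator hΩ.isOpen.measurableSet]
  have hae : Ω.indicator (fun x => fderiv ℝ w x e) =ᵐ[volume]
      fun x => ∑ p ∈ P, crossing Ω e p x * fderiv ℝ w x e := by
    filter_upwards [hP.ae_line e] with x hx
    rw [← Finset.sum_mul, ← hP.indicator_eq_sum_crossing hΩ he hx]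
    by_cases hxΩ : x ∈ Ω <;> simp [hxΩ]
  rw [integral_congr_ae hae, integral_finsetSum]
  · exact Finset.sum_congr rfl fun p hp =>
      integral_crossing_mul_fderiv hw hc he (hP.norm_eq_one p hp)
  · intro p _
    exact hg.bdd_mul (c := 1) (measurable_crossing e p).aestronglyMeasurable
      (Eventually.of_forall fun x => abs_crossing_le e p x)

/-- The divergence theorem on a polygonal domain, for smooth functions. -/
theorem IsPolygonalDomain.setIntegral_pderiv (hΩ : IsPolygonalDomain Ω) {w : E (m + 1) → ℝ}
    (hw : ContDiff ℝ ∞ w) (i : Fin (m + 1)) :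
    ∫ x in Ω, pderiv i w x = ∫ x, w x * normal Ω x i ∂(surf Ω) := by
  obtain ⟨R, hR0, hR⟩ := hΩ.isBounded.closure.exists_pos_norm_lt
  -- A cutoff equal to 1 near the closure of Ω changes neither integral.
  let χ : ContDiffBump (0 : E (m + 1)) := ⟨R, R + 1, hR0, by linarith⟩
  have hχ : ∀ x ∈ closure Ω, (fun x => χ x * w x) =ᶠ[𝓝 x] w := by
    intro x hx
    have hmem : x ∈ Metric.ball (0 : E (m + 1)) R := by simpa using hR x hx
    filter_upwards [Metric.isOpen_ball.mem_nhds hmem] with y hy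
    rw [χ.one_of_mem_closedBall (Metric.ball_subset_closedBall hy), one_mul]
  have h := hΩ.setIntegral_fderiv (w := fun x => χ x * w x)
    (χ.contDiff.mul (hw.of_le (by exact_mod_cast le_top))) χ.hasCompactSupport.mul_right
    (EuclideanSpace.single i 1)
  have h1 : ∫ x in Ω, pderiv i w x =
      ∫ x in Ω, fderiv ℝ (fun x => χ x * w x) x (EuclideanSpace.single i 1) := by
    refine setIntegral_congr_fun hΩ.isOpen.measurableSet fun x hx => ?_
    rw [(hχ x (subset_closure hx)).fderiv_eq]
    rfl
  rw [h1, h]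
  refine setIntegral_congr_fun isClosed_frontier.measurableSet fun x hx => ?_
  rw [show χ x * w x = w x from (hχ x (frontier_subset_closure hx)).self_of_nhds]
  simp [EuclideanSpace.inner_single_right]

/-! ### Traces -/

lemma tendsto_integral_of_eLpNorm_two {α : Type*} [MeasurableSpace α] {μ : Measure α}
    [IsFiniteMeasure μ] {F : ℕ → α → ℝ} {f : α → ℝ} (hF : ∀ k, AEStronglyMeasurable (F k) μ)
    (hf : MemLp f 2 μ) (h : Tendsto (fun k => eLpNorm (fun x => F k x - f x) 2 μ) atTop (𝓝 0)) :
    Tendsto (fun k => ∫ x, F k x ∂μ) atTop (𝓝 (∫ x, f x ∂μ)) := by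
  refine tendsto_integral_of_L1' f hf.aestronglyMeasurable ?_ ?_
  -- The functions `F k` are not assumed to be in L²; they are as soon as their distance to f is
  -- finite.
  · filter_upwards [h.eventually_lt_const (u := 1) (by simp)] with k hk
    have h1 : MemLp (fun x => F k x - f x) 2 μ :=
      ⟨(hF k).sub hf.aestronglyMeasurable, hk.trans (by simp)⟩
    have h2 := (h1.add hf).integrable (by norm_num)
    refine h2.congr (Eventually.of_forall fun x => ?_)
    simp
  · have hle (k) : eLpNorm (F k - f) 1 μ ≤ eLpNorm (fun x => F k x - f x) 2 μ *
        μ univ ^ (1 / (1 : ENNReal).toReal - 1 / (2 : ENNReal).toReal) :=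
      eLpNorm_le_eLpNorm_mul_rpow_measure_univ (by norm_num) ((hF k).sub hf.aestronglyMeasurable)
    refine tendsto_of_tendsto_of_tendsto_of_le_of_le tendsto_const_nhds ?_ (fun _ => zero_le) hle
    have := ENNReal.Tendsto.mul_const (b := μ univ ^ (1 / (1 : ENNReal).toReal -
      1 / (2 : ENNReal).toReal)) h (Or.inr (ENNReal.rpow_ne_top_of_nonneg (by norm_num)
        (measure_ne_top μ univ)))
    simpa using this

lemma IsPolygonalDomain.isFiniteMeasure_restrict {d : ℕ} {Ω : Set (E d)}
    (hΩ : IsPolygonalDomain Ω) : IsFiniteMeasure (volume.restrict Ω) :=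
  ⟨by rw [Measure.restrict_apply_univ]; exact hΩ.isBounded.measure_lt_top⟩

/-- The divergence theorem for functions in `H¹(Ω)` that have a trace. -/
theorem IsTrace.integral_pd (hΩ : IsPolygonalDomain Ω) {v : H1 Ω} {γ : L2bd Ω} (h : IsTrace v γ)
    (i : Fin (m + 1)) : ∫ x in Ω, pd v i x = ∫ x, γ x * normal Ω x i ∂(surf Ω) := by
  obtain ⟨w, hw, -, hgrad, htr⟩ := h
  have := hΩ.isFiniteMeasure_surf
  have := hΩ.isFiniteMeasure_restrict
  have h1 := tendsto_integral_of_eLpNorm_two (μ := volume.restrict Ω)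
    (fun k => (((hw k).continuous_fderiv (by simp)).clm_apply
      continuous_const).aestronglyMeasurable) (Lp.memLp (pd v i)) (hgrad i)
  have hn := hΩ.aestronglyMeasurable_normal i
  have hbound (x : E (m + 1)) : ‖normal Ω x i‖ ≤ 1 :=
    (PiLp.norm_apply_le (normal Ω x) i).trans (norm_normal_le x)
  have h2 : Tendsto (fun k => ∫ x, w k x * normal Ω x i ∂(surf Ω)) atTop
      (𝓝 (∫ x, γ x * normal Ω x i ∂(surf Ω))) := by
    refine tendsto_integral_of_eLpNorm_two
      (fun k => (hw k).continuous.aestronglyMeasurable.mul hn) ?_ ?_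
    · refine (Lp.memLp γ).mono ((Lp.aestronglyMeasurable γ).mul hn)
        (Eventually.of_forall fun x => ?_)
      rw [norm_mul]
      exact mul_le_of_le_one_right (norm_nonneg _) (hbound x)
    · refine tendsto_of_tendsto_of_tendsto_of_le_of_le tendsto_const_nhds htr
        (fun _ => zero_le) fun k => eLpNorm_mono fun x => ?_
      rw [← sub_mul, norm_mul]
      exact mul_le_of_le_one_right (norm_nonneg _) (hbound x)
  refine tendsto_nhds_unique h1 (h2.congr fun k => ?_)
  exact (hΩ.setIntegral_pderiv (hw k) i).symm

/-! ### Smooth functions as elements of `H¹` -/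

lemma memLp_two_of_continuous {d : ℕ} {Ω : Set (E d)} (hΩ : IsPolygonalDomain Ω)
    {μ : Measure (E d)} [IsFiniteMeasure μ] (hμ : ∀ᵐ x ∂μ, x ∈ closure Ω) {w : E d → ℝ}
    (hw : Continuous w) : MemLp w 2 μ := by
  obtain ⟨C, hC⟩ := hΩ.isBounded.isCompact_closure.exists_bound_of_continuousOn hw.continuousOn
  exact MemLp.of_bound hw.aestronglyMeasurable C (hμ.mono hC)

/-- The test function and its derivatives vanish off Ω, so this is integration by parts on the whole
space, without boundary terms. -/
lemma setIntegral_mul_pderiv {d : ℕ} {Ω : Set (E d)} {w φ : E d → ℝ} (hw : ContDiff ℝ ∞ w)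
    (hφ : IsTestFun Ω φ) (i : Fin d) :
    ∫ x in Ω, w x * pderiv i φ x = -∫ x in Ω, pderiv i w x * φ x := by
  have hφ0 : ∀ x, x ∉ Ω → φ x = 0 := fun x hx =>
    image_eq_zero_of_notMem_tsupport fun h => hx (hφ.tsupport_subset h)
  have hdφ0 : ∀ x, x ∉ Ω → pderiv i φ x = 0 := fun x hx => by
    have : fderiv ℝ φ x = 0 := image_eq_zero_of_notMem_tsupport fun h =>
      hx (hφ.tsupport_subset (tsupport_fderiv_subset ℝ h))
    simp [pderiv, this]
  rw [setIntegral_eq_integral_of_forall_compl_eq_zero (fun x hx => by rw [hdφ0 x hx, mul_zero]),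
    setIntegral_eq_integral_of_forall_compl_eq_zero (fun x hx => by rw [hφ0 x hx, mul_zero])]
  have hwc : Continuous (pderiv i w) :=
    (hw.continuous_fderiv (by simp)).clm_apply continuous_const
  refine integral_mul_fderiv_eq_neg_fderiv_mul_of_integrable ?_ ?_ ?_
    (fun x _ => hw.differentiable (by simp) x) (fun x _ => hφ.contDiff.differentiable (by simp) x)
  · exact (hwc.mul hφ.contDiff.continuous).integrable_of_hasCompactSupport
      hφ.hasCompactSupport.mul_left
  · exact (hw.continuous.mul (hφ.continuous_pderiv i)).integrable_of_hasCompactSupport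
      (hφ.hasCompactSupport_pderiv i).mul_left
  · exact (hw.continuous.mul hφ.contDiff.continuous).integrable_of_hasCompactSupport
      hφ.hasCompactSupport.mul_left

/-- Smooth functions belong to `H¹(Ω)`, and their traces are their restrictions. -/
lemma IsPolygonalDomain.exists_H1_of_contDiff (hΩ : IsPolygonalDomain Ω) {w : E (m + 1) → ℝ}
    (hw : ContDiff ℝ ∞ w) : ∃ (v : H1 Ω) (γ : L2bd Ω), toL2 v =ᵐ[volume.restrict Ω] w ∧
      (∀ i, pd v i =ᵐ[volume.restrict Ω] pderiv i w) ∧ γ =ᵐ[surf Ω] w ∧ IsTrace v γ := by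
  have := hΩ.isFiniteMeasure_surf
  have := hΩ.isFiniteMeasure_restrict
  have hvol : ∀ᵐ x ∂(volume.restrict Ω), x ∈ closure Ω :=
    (ae_restrict_mem hΩ.isOpen.measurableSet).mono fun x hx => subset_closure hx
  have hsurf : ∀ᵐ x ∂(surf Ω), x ∈ closure Ω :=
    (ae_restrict_mem isClosed_frontier.measurableSet).mono fun x hx => frontier_subset_closure hx
  have hdw (i) : Continuous (pderiv i w) :=
    (hw.continuous_fderiv (by simp)).clm_apply continuous_const
  have h0 := memLp_two_of_continuous hΩ hvol hw.continuous
  have h1 (i) := memLp_two_of_continuous hΩ hvol (hdw i)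
  have h2 := memLp_two_of_continuous hΩ hsurf hw.continuous
  let v : H1 Ω := ⟨WithLp.toLp 2 (h0.toLp, WithLp.toLp 2 fun i => (h1 i).toLp), by
    intro φ hφ i
    have e1 : ip Ω (h0.toLp : L2 Ω) (pderiv i φ) = ∫ x in Ω, w x * pderiv i φ x :=
      integral_congr_ae (h0.coeFn_toLp.mono fun x hx => by simp only [hx])
    have e2 : ip Ω ((h1 i).toLp : L2 Ω) φ = ∫ x in Ω, pderiv i w x * φ x :=
      integral_congr_ae ((h1 i).coeFn_toLp.mono fun x hx => by simp only [hx])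
    exact e1.trans ((setIntegral_mul_pderiv hw hφ i).trans (congrArg Neg.neg e2.symm))⟩
  have hv : toL2 v =ᵐ[volume.restrict Ω] w := h0.coeFn_toLp
  have hdv (i) : pd v i =ᵐ[volume.restrict Ω] pderiv i w := (h1 i).coeFn_toLp
  have hγ : (h2.toLp : L2bd Ω) =ᵐ[surf Ω] w := h2.coeFn_toLp
  have hzero {μ : Measure (E (m + 1))} {f g : E (m + 1) → ℝ} (h : f =ᵐ[μ] g) :
      Tendsto (fun _ : ℕ => eLpNorm (fun x => g x - f x) 2 μ) atTop (𝓝 0) := by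
    have : (fun x => g x - f x) =ᵐ[μ] 0 := h.mono fun x hx => by simp [hx]
    rw [eLpNorm_congr_ae this, eLpNorm_zero]
    exact tendsto_const_nhds
  exact ⟨v, h2.toLp, hv, hdv, hγ, fun _ => w, fun _ => hw, hzero hv, fun i => hzero (hdv i),
    hzero hγ⟩

/-! ### Functions of time -/

instance (T : ℝ) : IsFiniteMeasure (timeMeasure T) :=
  ⟨by rw [timeMeasure, Measure.restrict_apply_univ]; exact measure_Ioo_lt_top⟩

lemma exists_Icc_superset_of_isCompact {T : ℝ} (hT : 0 < T) {K : Set ℝ} (hK : IsCompact K)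
    (hs : K ⊆ Ioo 0 T) : ∃ a b, 0 < a ∧ b < T ∧ K ⊆ Icc a b := by
  rcases K.eq_empty_or_nonempty with rfl | hne
  · exact ⟨T / 2, T / 2, by linarith, by linarith, empty_subset _⟩
  · obtain ⟨a, ha⟩ := hK.exists_isLeast hne
    obtain ⟨b, hb⟩ := hK.exists_isGreatest hne
    exact ⟨a, b, (hs ha.1).1, (hs hb.1).2, fun x hx => ⟨ha.2 hx, hb.2 hx⟩⟩

/-- A test function with vanishing mean is the derivative of a test function. -/
lemma exists_antideriv_of_integral_eq_zero {T : ℝ} (hT : 0 < T) {k : ℝ → ℝ} (hk : ContDiff ℝ ∞ k)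
    (hc : HasCompactSupport k) (hs : tsupport k ⊆ Ioo 0 T) (h0 : ∫ t, k t = 0) :
    ∃ θ : ℝ → ℝ, ContDiff ℝ ∞ θ ∧ HasCompactSupport θ ∧ tsupport θ ⊆ Ioo 0 T ∧ deriv θ = k := by
  obtain ⟨a, b, ha, hb, hab⟩ := exists_Icc_superset_of_isCompact hT hc hs
  have hder (t : ℝ) : HasDerivAt (fun t => ∫ s in (0 : ℝ)..t, k s) (k t) t :=
    hk.continuous.integral_hasStrictDerivAt 0 t |>.hasDerivAt
  have hderiv : deriv (fun t => ∫ s in (0 : ℝ)..t, k s) = k := funext fun t => (hder t).deriv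
  have hk0 : ∀ s, s ∉ Icc a b → k s = 0 := fun s h =>
    image_eq_zero_of_notMem_tsupport fun h' => h (hab h')
  have hsupp : ∀ t, t ∉ Icc a b → ∫ s in (0 : ℝ)..t, k s = 0 := by
    intro t ht
    rcases lt_or_ge t a with hta | hta
    · rw [intervalIntegral.integral_congr (g := fun _ => 0), intervalIntegral.integral_zero]
      intro s hs
      refine hk0 s fun h => ?_
      rcases mem_uIcc.1 hs with h' | h' <;> linarith [h.1, h'.1, h'.2]
    · have hbt : b < t := lt_of_not_ge fun h => ht ⟨hta, h⟩
      rw [intervalIntegral.integral_of_le (ha.le.trans hta)]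
      refine (setIntegral_eq_integral_of_forall_compl_eq_zero fun s hs => hk0 s fun h => hs ?_).trans
        h0
      exact ⟨ha.trans_le h.1, h.2.trans hbt.le⟩
  have htsupp : tsupport (fun t => ∫ s in (0 : ℝ)..t, k s) ⊆ Icc a b :=
    closure_minimal (fun t ht => by_contra fun h => ht (hsupp t h)) isClosed_Icc
  refine ⟨fun t => ∫ s in (0 : ℝ)..t, k s, ?_, ?_, ?_, hderiv⟩
  · rw [contDiff_infty_iff_deriv, hderiv]
    exact ⟨fun t => (hder t).differentiableAt, hk⟩
  · exact HasCompactSupport.intro isCompact_Icc hsupp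
  · exact htsupp.trans fun t ht => ⟨ha.trans_le ht.1, ht.2.trans_lt hb⟩

lemma integrable_mul_timeMeasure {T : ℝ} {g G : ℝ → ℝ} (hg : Continuous g)
    (hc : HasCompactSupport g) (hG : Integrable G (timeMeasure T)) :
    Integrable (fun t => g t * G t) (timeMeasure T) := by
  obtain ⟨C, hC⟩ := hg.bounded_above_of_compact_support hc
  exact hG.bdd_mul hg.aestronglyMeasurable (Eventually.of_forall hC)

lemma integral_timeMeasure_eq {T : ℝ} {f : ℝ → ℝ} (h : ∀ t, t ∉ Ioo 0 T → f t = 0) :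
    ∫ t, f t ∂(timeMeasure T) = ∫ t, f t :=
  setIntegral_eq_integral_of_forall_compl_eq_zero h

/-- The lemma of du Bois-Reymond. -/
lemma ae_eq_const_of_forall_integral_deriv_mul {T : ℝ} (hT : 0 < T) {G : ℝ → ℝ}
    (hG : Integrable G (timeMeasure T))
    (h : ∀ θ : ℝ → ℝ, ContDiff ℝ ∞ θ → HasCompactSupport θ → tsupport θ ⊆ Ioo 0 T →
      ∫ t, deriv θ t * G t ∂(timeMeasure T) = 0) :
    ∃ C, ∀ᵐ t ∂(timeMeasure T), G t = C := by
  let ρ : ContDiffBump (T / 2) := ⟨T / 8, T / 4, by linarith, by linarith⟩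
  have hρc : ContDiff ℝ ∞ (ρ.normed volume) := ρ.contDiff_normed
  have hρs : HasCompactSupport (ρ.normed volume) := ρ.hasCompactSupport_normed
  have hρt : tsupport (ρ.normed volume) ⊆ Ioo 0 T := by
    rw [ρ.tsupport_normed_eq, Real.closedBall_eq_Icc]
    intro t ht
    have h1 := ht.1
    have h2 := ht.2
    simp only [ρ] at h1 h2
    constructor <;> linarith
  set C := ∫ t, ρ.normed volume t * G t ∂(timeMeasure T) with hC
  refine ⟨C, ?_⟩
  have hGC : Integrable (fun t => G t - C) (timeMeasure T) := hG.sub (integrable_const C)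
  have key := isOpen_Ioo.ae_eq_zero_of_integral_contDiff_smul_eq_zero (μ := volume)
    (U := Ioo 0 T) (f := fun t => G t - C) ?_ ?_
  · rw [timeMeasure, ae_restrict_iff' measurableSet_Ioo]
    filter_upwards [key] with t ht hmem using sub_eq_zero.1 (ht hmem)
  · exact IntegrableOn.locallyIntegrableOn hGC
  · intro g hg hgc hgs
    have hgI : Integrable g := hg.continuous.integrable_of_hasCompactSupport hgc
    have hρI : Integrable (ρ.normed volume) := hρc.continuous.integrable_of_hasCompactSupport hρs
    have hsub : tsupport (fun t => g t - (∫ s, g s) * ρ.normed volume t) ⊆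
        tsupport g ∪ tsupport (ρ.normed volume) := by
      refine closure_minimal (fun t ht => ?_)
        ((isClosed_tsupport _).union (isClosed_tsupport _))
      by_contra hcon
      simp only [mem_union, not_or] at hcon
      exact ht (by simp [image_eq_zero_of_notMem_tsupport hcon.1,
        image_eq_zero_of_notMem_tsupport hcon.2])
    -- Subtracting the multiple of the normalised bump with the same integral leaves mean zero,
    -- hence a derivative of a test function, against which G integrates to zero.
    obtain ⟨θ, hθ1, hθ2, hθ3, hθ4⟩ := exists_antideriv_of_integral_eq_zero hT
      (k := fun t => g t - (∫ s, g s) * ρ.normed volume t) (hg.sub (contDiff_const.mul hρc))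
      ((hgc.union hρs).of_isClosed_subset (isClosed_tsupport _) hsub) (hsub.trans (union_subset hgs hρt)) (by
        rw [integral_sub hgI (hρI.const_mul _), integral_const_mul, ρ.integral_normed]
        ring)
    have h1 := h θ hθ1 hθ2 hθ3
    have e1 : Integrable (fun t => g t * G t) (timeMeasure T) :=
      integrable_mul_timeMeasure hg.continuous hgc hG
    have e2 : Integrable (fun t => ρ.normed volume t * G t) (timeMeasure T) :=
      integrable_mul_timeMeasure hρc.continuous hρs hG
    have e3 : ∫ t, deriv θ t * G t ∂(timeMeasure T) =
        ∫ t, g t * G t ∂(timeMeasure T) - (∫ s, g s) * C := by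
      rw [hθ4, hC, ← integral_const_mul, ← integral_sub e1 (e2.const_mul _)]
      refine integral_congr_ae (Eventually.of_forall fun t => ?_)
      simp only
      ring
    have hg0 : ∀ t, t ∉ Ioo 0 T → g t = 0 := fun t ht =>
      image_eq_zero_of_notMem_tsupport fun h' => ht (hgs h')
    have e4 : ∫ t, g t • (G t - C) = ∫ t, g t * (G t - C) ∂(timeMeasure T) :=
      (integral_timeMeasure_eq fun t ht => by rw [hg0 t ht, zero_smul]).symm
    have e5 : ∫ t, g t ∂(timeMeasure T) = ∫ t, g t := integral_timeMeasure_eq hg0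
    have e6 : Integrable g (timeMeasure T) := hgI.mono_measure Measure.restrict_le_self
    rw [e4]
    simp only [mul_sub]
    rw [integral_sub e1 (e6.mul_const C), integral_mul_const, e5, ← e3, h1]

lemma integral_deriv_mul_id {T : ℝ} {θ : ℝ → ℝ} (hθ : ContDiff ℝ ∞ θ) (hc : HasCompactSupport θ)
    (hs : tsupport θ ⊆ Ioo 0 T) :
    ∫ t, deriv θ t * t ∂(timeMeasure T) = -∫ t, θ t ∂(timeMeasure T) := by
  have hθ0 : ∀ t, t ∉ Ioo 0 T → θ t = 0 := fun t ht =>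
    image_eq_zero_of_notMem_tsupport fun h' => ht (hs h')
  have hdθ0 : ∀ t, t ∉ Ioo 0 T → deriv θ t = 0 := fun t ht =>
    image_eq_zero_of_notMem_tsupport fun h' => ht (hs (tsupport_deriv_subset h'))
  have hdc : Continuous (deriv θ) := hθ.continuous_deriv (by simp)
  rw [integral_timeMeasure_eq fun t ht => by rw [hdθ0 t ht, zero_mul],
    integral_timeMeasure_eq hθ0]
  have := integral_mul_deriv_eq_deriv_mul_of_integrable (u := fun t : ℝ => t) (u' := fun _ => 1)
    (v := θ) (v' := deriv θ) (fun t _ => hasDerivAt_id t)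
    (fun t _ => (hθ.differentiable (by simp) t).hasDerivAt)
    ((continuous_id.mul hdc).integrable_of_hasCompactSupport hc.deriv.mul_left)
    ((continuous_const.mul hθ.continuous).integrable_of_hasCompactSupport hc.mul_left)
    ((continuous_id.mul hθ.continuous).integrable_of_hasCompactSupport hc.mul_left)
  simpa [mul_comm] using this

/-- A function with constant weak derivative is affine. -/
lemma ae_eq_affine_of_forall_integral_deriv_mul {T : ℝ} (hT : 0 < T) {F : ℝ → ℝ} {c : ℝ}
    (hF : Integrable F (timeMeasure T))
    (h : ∀ θ : ℝ → ℝ, ContDiff ℝ ∞ θ → HasCompactSupport θ → tsupport θ ⊆ Ioo 0 T →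
      ∫ t, deriv θ t * F t ∂(timeMeasure T) = -∫ t, θ t * c ∂(timeMeasure T)) :
    ∃ C, ∀ᵐ t ∂(timeMeasure T), F t = C + c * t := by
  have hid : Integrable (fun t : ℝ => t) (timeMeasure T) :=
    (continuous_id.continuousOn.integrableOn_Icc (a := 0) (b := T)).mono_set Ioo_subset_Icc_self
  obtain ⟨C, hC⟩ := ae_eq_const_of_forall_integral_deriv_mul hT (hF.sub (hid.const_mul c))
    fun θ h1 h2 h3 => by
      have hdc : Continuous (deriv θ) := h1.continuous_deriv (by simp)
      have e1 := integrable_mul_timeMeasure hdc h2.deriv hF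
      have e2 := integrable_mul_timeMeasure hdc h2.deriv hid
      have e3 : ∫ t, deriv θ t * (F - fun t => c * t) t ∂(timeMeasure T) =
          ∫ t, deriv θ t * F t ∂(timeMeasure T) - c * ∫ t, deriv θ t * t ∂(timeMeasure T) := by
        rw [← integral_const_mul, ← integral_sub e1 (e2.const_mul c)]
        refine integral_congr_ae (Eventually.of_forall fun t => ?_)
        simp only [Pi.sub_apply]
        ring
      refine e3.trans ?_
      rw [h θ h1 h2 h3, integral_deriv_mul_id h1 h2 h3, integral_mul_const]
      ring
  refine ⟨C, hC.mono fun t ht => ?_⟩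
  simp only [Pi.sub_apply] at ht
  linarith

/-- Intervals (0, ε) have positive measure, so a conull set meets each of them. This makes essential
limits at 0⁺ unique. -/
instance : (𝓝[>] (0 : ℝ) ⊓ ae volume).NeBot := by
  rw [Filter.inf_neBot_iff]
  intro s hs s' hs'
  obtain ⟨ε, hε, hsub⟩ := mem_nhdsGT_iff_exists_Ioo_subset.1 hs
  have hε : 0 < ε := hε
  by_contra hcon
  have h1 : Ioo 0 ε ⊆ s'ᶜ := fun t ht ht' => hcon ⟨t, hsub ht, ht'⟩
  have h2 : volume (Ioo (0 : ℝ) ε) = 0 := measure_mono_null h1 hs'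
  rw [Real.volume_Ioo] at h2
  simp at h2
  linarith

lemma eventually_of_ae_timeMeasure {T : ℝ} (hT : 0 < T) {p : ℝ → Prop}
    (h : ∀ᵐ t ∂(timeMeasure T), p t) : ∀ᶠ t in 𝓝[>] 0 ⊓ ae volume, p t := by
  rw [timeMeasure, ae_restrict_iff' measurableSet_Ioo] at h
  have hT' : ∀ᶠ t in 𝓝[>] (0 : ℝ), t ∈ Ioo 0 T := Ioo_mem_nhdsGT hT
  filter_upwards [h.filter_mono inf_le_right, hT'.filter_mono inf_le_left] with t h1 h2
  exact h1 h2

/-! ### Pairings with constants and coordinate functions -/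

lemma ip_eq_inner {d : ℕ} {Ω : Set (E d)} (a b : L2 Ω) : ip Ω a b = inner ℝ a b := by
  rw [L2.inner_def]
  refine integral_congr_ae (Eventually.of_forall fun x => ?_)
  simp [mul_comm]

lemma ip_congr_right {d : ℕ} {Ω : Set (E d)} {a b b' : E d → ℝ}
    (h : b =ᵐ[volume.restrict Ω] b') : ip Ω a b = ip Ω a b' :=
  integral_congr_ae (h.mono fun x hx => by simp only [hx])

lemma bp_congr_right {d : ℕ} {Ω : Set (E d)} {a b b' : E d → ℝ}
    (h : b =ᵐ[surf Ω] b') : bp Ω a b = bp Ω a b' :=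
  integral_congr_ae (h.mono fun x hx => by simp only [hx])

lemma ip_zero_right {d : ℕ} {Ω : Set (E d)} (a : E d → ℝ) : ip Ω a (0 : L2 Ω) = 0 := by
  rw [ip_congr_right (Lp.coeFn_zero _ _ _)]
  simp [ip]

/-- The constant function `1` as an element of `H¹(Ω)`. -/
lemma IsPolygonalDomain.exists_H1_one (hΩ : IsPolygonalDomain Ω) :
    ∃ (o : H1 Ω) (γ : L2bd Ω), toL2 o =ᵐ[volume.restrict Ω] 1 ∧ (∀ i, pd o i = 0) ∧
      γ =ᵐ[surf Ω] 1 ∧ IsTrace o γ := by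
  obtain ⟨o, γ, h1, h2, h3, h4⟩ := hΩ.exists_H1_of_contDiff (w := 1) contDiff_const
  refine ⟨o, γ, h1, fun i => Lp.ext ?_, h3, h4⟩
  filter_upwards [h2 i, Lp.coeFn_zero ℝ 2 (volume.restrict Ω)] with x hx h0
  rw [hx, h0, pderiv, fderiv_one]
  simp

/-- The coordinate functions as elements of `H¹(Ω)`. -/
lemma IsPolygonalDomain.exists_H1_coord (hΩ : IsPolygonalDomain Ω) {o : L2 Ω}
    (ho : o =ᵐ[volume.restrict Ω] 1) (i : Fin (m + 1)) :
    ∃ (X : H1 Ω) (γ : L2bd Ω), toL2 X =ᵐ[volume.restrict Ω] (fun x => x i) ∧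
      (∀ j, pd X j = if i = j then o else 0) ∧ γ =ᵐ[surf Ω] (fun x => x i) ∧ IsTrace X γ := by
  obtain ⟨X, γ, h1, h2, h3, h4⟩ := hΩ.exists_H1_of_contDiff (w := fun x => x i)
    (EuclideanSpace.proj i : E (m + 1) →L[ℝ] ℝ).contDiff
  refine ⟨X, γ, h1, fun j => Lp.ext ?_, h3, h4⟩
  filter_upwards [h2 j, Lp.coeFn_zero ℝ 2 (volume.restrict Ω), ho] with x hx h0 hox
  have : fderiv ℝ (fun x : E (m + 1) => x i) x = EuclideanSpace.proj i :=
    (EuclideanSpace.proj i : E (m + 1) →L[ℝ] ℝ).fderiv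
  rw [hx, pderiv, this]
  split_ifs with hij
  · simp [hox, hij]
  · exact Eq.trans (by simp [hij]) h0.symm

/-- Here X stands for the field x ↦ x and o for the constant 1: the strain of X is the identity
matrix, and contracting with it takes the trace of ε(u). -/
lemma sum_ip_strain_identity {d : ℕ} {Ω : Set (E d)} (u X : H1V Ω) {o : L2 Ω}
    (hX : ∀ i j, pd (X i) j = if i = j then o else 0) :
    ∑ i, ∑ j, ip Ω (strain u i j) (strain X i j) = ip Ω (div u) o := by
  have hs (i j) : strain X i j = if i = j then o else 0 := by
    rw [strain, hX, hX]
    by_cases h : i = j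
    · simp [h, ← two_smul ℝ o, smul_smul]
    · simp [h, Ne.symm h]
  have hd (i) : strain u i i = pd (u i) i := by
    rw [strain, ← two_smul ℝ, smul_smul]
    norm_num
  simp only [ip_eq_inner, hs, div, sum_inner]
  refine Finset.sum_congr rfl fun i _ => ?_
  rw [Finset.sum_eq_single i (fun j _ hj => by simp [hj.symm]) (by simp)]
  simp [hd]

/-- The total flux through the boundary is the integral of the divergence. -/
lemma IsTraceV.bp_normal_eq (hΩ : IsPolygonalDomain Ω) {v : H1V Ω} {γ : Fin (m + 1) → L2bd Ω}
    (h : IsTraceV v γ) : bp Ω (fun x => ∑ i, γ i x * normal Ω x i) 1 = ip Ω (div v) 1 := by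
  have := hΩ.isFiniteMeasure_surf
  have := hΩ.isFiniteMeasure_restrict
  have h1 : bp Ω (fun x => ∑ i, γ i x * normal Ω x i) 1 =
      ∑ i, ∫ x, γ i x * normal Ω x i ∂(surf Ω) := by
    rw [← integral_finsetSum _ fun i _ => hΩ.integrable_mul_normal
      ((Lp.memLp (γ i)).integrable (by norm_num)) i]
    simp [bp]
  have h2 : ip Ω (div v) 1 = ∑ i, ∫ x in Ω, pd (v i) i x := by
    rw [← integral_finsetSum _ fun i _ => (Lp.memLp (pd (v i) i)).integrable (by norm_num)]
    refine integral_congr_ae ?_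
    filter_upwards [Lp.coeFn_finsetSum Finset.univ fun i => pd (v i) i] with x hx
    simpa [div] using hx
  rw [h1, h2]
  exact Finset.sum_congr rfl fun i _ => ((h i).integral_pd hΩ i).symm

/-! ### Integral identities for weak solutions -/

namespace Data.IsWeakSolution

variable {D : Data Ω} {T : ℝ} {u : ℝ → H1V Ω} {ξ η : ℝ → L2 Ω} {p : ℝ → H1 Ω} {q : ℝ → L2 Ω}

/-- Conservation of the fluid content. -/
lemma ip_η_one (hsol : D.IsWeakSolution T u ξ η p q) (hΩ : IsPolygonalDomain Ω) (hT : 0 < T) :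
    ∀ᵐ t ∂(timeMeasure T), ip Ω (η t) 1 = ip Ω D.η₀ 1 + (ip Ω D.φ 1 + bp Ω D.φ₁ 1) * t := by
  obtain ⟨o, γ, ho, hdo, hγ, htr⟩ := hΩ.exists_H1_one
  obtain ⟨ηt, -, hder, heq⟩ := hsol.diffusion
  simp only [← ip_congr_right ho, ← bp_congr_right hγ]
  -- The flux term drops because the constant test function has zero gradient.
  have hηt : ∀ᵐ t ∂(timeMeasure T), ηt t o = ip Ω D.φ (toL2 o) + bp Ω D.φ₁ γ := by
    filter_upwards [heq] with t ht
    have := ht o γ htr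
    rwa [Finset.sum_eq_zero fun i _ => by rw [hdo i, ip_zero_right], mul_zero, add_zero] at this
  have hint : Integrable (fun t => ip Ω (η t) (toL2 o)) (timeMeasure T) := by
    simp only [ip_eq_inner]
    exact (hsol.η_mem.integrable le_top).inner_const (toL2 o)
  obtain ⟨C, hC⟩ := ae_eq_affine_of_forall_integral_deriv_mul hT
    (c := ip Ω D.φ (toL2 o) + bp Ω D.φ₁ γ) hint fun θ h1 h2 h3 => by
    rw [hder θ h1 h2 h3 o]
    exact congrArg Neg.neg (integral_congr_ae (hηt.mono fun t ht => by simp only [ht]))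
  have hlim : Tendsto (fun t => C + (ip Ω D.φ (toL2 o) + bp Ω D.φ₁ γ) * t)
      (𝓝[>] 0 ⊓ ae volume) (𝓝 C) := by
    have : Continuous fun t => C + (ip Ω D.φ (toL2 o) + bp Ω D.φ₁ γ) * t := by fun_prop
    exact (this.tendsto' 0 C (by simp)).mono_left (inf_le_left.trans nhdsWithin_le_nhds)
  have hC0 : C = ip Ω D.η₀ (toL2 o) := by
    refine tendsto_nhds_unique (hlim.congr' ?_) (hsol.η_init o)
    exact (eventually_of_ae_timeMeasure hT hC).mono fun t ht => ht.symm
  rwa [hC0] at hC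

lemma ip_div_one (hsol : D.IsWeakSolution T u ξ η p q) (hΩ : IsPolygonalDomain Ω) :
    ∀ᵐ t ∂(timeMeasure T),
      ip Ω (div (u t)) 1 = D.κ₁ * ip Ω (η t) 1 - D.κ₃ * ip Ω (ξ t) 1 := by
  obtain ⟨o, γ, ho, -⟩ := hΩ.exists_H1_one
  filter_upwards [hsol.volumetric] with t ht
  have := ht (toL2 o)
  simp only [ip_congr_right ho] at this
  linarith

lemma ip_ξ_one (hsol : D.IsWeakSolution T u ξ η p q) (hΩ : IsPolygonalDomain Ω)
    (hD : D.Admissible) :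
    ∀ᵐ t ∂(timeMeasure T), ip Ω (ξ t) 1 = 1 / ((m + 1 : ℕ) + D.μ * D.κ₃) *
        (D.μ * D.κ₁ * ip Ω (η t) 1 - ∑ i, ip Ω (D.f i) (fun x => x i)
          - ∑ i, bp Ω (D.f₁ i) (fun x => x i)) := by
  obtain ⟨o, γ, ho, -⟩ := hΩ.exists_H1_one
  choose X δ hX hdX hδ htr using hΩ.exists_H1_coord ho
  -- The sign condition c₀ ≥ 0 gives κ₃ ≥ 0, which allows solving for (ξ, 1).
  have hpos : 0 < ((m + 1 : ℕ) : ℝ) + D.μ * D.κ₃ := by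
    have h1 : 0 ≤ D.κ₃ := div_nonneg hD.c₀_nonneg hD.denom_pos.le
    have h2 := mul_nonneg hD.μ_pos.le h1
    positivity
  have hdiv : div (WithLp.toLp 2 X : H1V Ω) = ((m + 1 : ℕ) : ℝ) • toL2 o := by
    simp only [div, hdX, if_true, Finset.sum_const, Finset.card_univ, Fintype.card_fin]
    rw [Nat.cast_smul_eq_nsmul]
  filter_upwards [hsol.momentum, hsol.ip_div_one hΩ] with t ht hd
  have h1 := ht (WithLp.toLp 2 X) δ htr
  rw [sum_ip_strain_identity (u t) (WithLp.toLp 2 X) hdX, hdiv, ip_congr_right ho, hd] at h1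
  have h2 : ip Ω (ξ t) (((m + 1 : ℕ) : ℝ) • toL2 o : L2 Ω) = (m + 1 : ℕ) * ip Ω (ξ t) 1 := by
    rw [← ip_congr_right ho, ip_eq_inner, ip_eq_inner, inner_smul_right]
  rw [h2] at h1
  simp only [fun i => ip_congr_right (a := D.f i) (hX i),
    fun i => bp_congr_right (a := D.f₁ i) (hδ i)] at h1
  rw [one_div, eq_inv_mul_iff_mul_eq₀ hpos.ne']
  linarith

end Data.IsWeakSolution

end Poro

open Poro in
theorem lemma2p4 {d : ℕ} (hd : 1 ≤ d) (Ω : Set (E d)) (hΩ : IsPolygonalDomain Ω)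
    (D : Data Ω) (hD : D.Admissible) (T : ℝ) (hT : 0 < T)
    (u : ℝ → H1V Ω) (ξ η : ℝ → L2 Ω) (p : ℝ → H1 Ω) (q : ℝ → L2 Ω)
    (hsol : D.IsWeakSolution T u ξ η p q) :
    (∀ᵐ t ∂(timeMeasure T),
      ip Ω (η t) 1 = ip Ω D.η₀ 1 + (ip Ω D.φ 1 + bp Ω D.φ₁ 1) * t ∧
      ip Ω (ξ t) 1 = 1 / (d + D.μ * D.κ₃) *
        (D.μ * D.κ₁ * ip Ω (η t) 1 - ∑ i, ip Ω (D.f i) (fun x => x i)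
          - ∑ i, bp Ω (D.f₁ i) (fun x => x i)) ∧
      ip Ω (q t) 1 = D.κ₁ * ip Ω (η t) 1 - D.κ₃ * ip Ω (ξ t) 1 ∧
      ip Ω (toL2 (p t)) 1 = D.κ₁ * ip Ω (ξ t) 1 + D.κ₂ * ip Ω (η t) 1 ∧
      ∀ γ : Fin d → L2bd Ω, IsTraceV (u t) γ →
        bp Ω (fun x => ∑ i, γ i x * normal Ω x i) 1 = ip Ω (q t) 1) ∧
    (∀ η' : ℝ → L2 Ω, η' =ᵐ[timeMeasure T] η →
      ContinuousOn (fun t => ip Ω (η' t) 1) (Set.Icc 0 T) →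
      ∀ t ∈ Set.Icc 0 T,
        ip Ω (η' t) 1 = ip Ω D.η₀ 1 + (ip Ω D.φ 1 + bp Ω D.φ₁ 1) * t) := by
  -- With d = m + 1 the surface dimension d - 1 is m, and hyperplanes are modelled on `E m`.
  obtain ⟨m, rfl⟩ : ∃ m, d = m + 1 := ⟨d - 1, by omega⟩
  obtain ⟨o, -, ho, -⟩ := hΩ.exists_H1_one
  have hη := hsol.ip_η_one hΩ hT
  constructor
  · filter_upwards [hη, hsol.ip_ξ_one hΩ hD, hsol.ip_div_one hΩ, hsol.q_eq, hsol.p_eq]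
      with t h1 h2 h3 h4 h5
    have hq : ip Ω (q t) 1 = D.κ₁ * ip Ω (η t) 1 - D.κ₃ * ip Ω (ξ t) 1 := by
      simp only [← ip_congr_right ho]
      simp only [ip_eq_inner, h4, inner_sub_left, real_inner_smul_left]
    have hp : ip Ω (toL2 (p t)) 1 = D.κ₁ * ip Ω (ξ t) 1 + D.κ₂ * ip Ω (η t) 1 := by
      simp only [← ip_congr_right ho]
      simp only [ip_eq_inner, h5, inner_add_left, real_inner_smul_left]
    exact ⟨h1, h2, hq, hp, fun γ hγ => (hγ.bp_normal_eq hΩ).trans (h3.trans hq.symm)⟩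
  · intro η' hη' hcont
    -- Two continuous functions that agree almost everywhere on the interval agree at every point of
    -- it, endpoints included.
    refine Measure.eqOn_Icc_of_ae_eq volume hT.ne ?_ hcont (by fun_prop)
    rw [← Measure.restrict_congr_set Ioo_ae_eq_Icc]
    filter_upwards [hη, hη'] with t h1 h2
    rw [h2, h1]
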